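/- Conventions. A language is computable if its symbols are natural numbers, its sets of function symbols and of relation symbols are computable, and arities are computable. A computable $\Sigma_1$ formula $\varphi(\bar x)$ is a computably enumerable disjunction of formulas $\exists \bar y\,\theta(\bar x,\bar y)$ with $\theta$ finitary and quantifier-free. A generalized computable $\Sigma_1$ formula $\Phi(\bar x_1,\dots,\bar x_k)$ in $k$ tuple variables of arbitrary finite lengths is a family of computable $\Sigma_1$ formulas $\varphi_{n_1,\dots,n_k}$, computable uniformly in the lengths $(n_1,\dots,n_k)$; tuples $\bar a_1,\dots,\bar a_k\in\mathcal B^{<\omega}$ satisfy $\Phi$ in $\mathcal B$ if they satisfy $\varphi_{|\bar a_1|,\dots,|\bar a_k|}$. The orbit of a tuple is its orbit under $\mathrm{Aut}(\mathcal B)$. Let $\mathcal A$ be a structure for a computable relational language with basic relations $R_i$ of arity $k_i$, and let $\mathcal B$ be a structure for a computable language. $\mathcal A$ is effectively defined in $\mathcal B$ with parameters $\bar b$ if there are $D(\bar b)\subseteq\mathcal B^{<\omega}$ and complementary relations $R_i(\bar b),\neg R_i(\bar b)$ on $D(\bar b)$ (of arity $k_i$) with $(D(\bar b),(R_i(\bar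 b))_i)\cong\mathcal A$, all defined by a uniformly computable sequence of generalized computable $\Sigma_1$ formulas with parameters $\bar b$. $\mathcal A$ is effectively interpreted in $\mathcal B$ without parameters if there are $D\subseteq\mathcal B^{<\omega}$, an equivalence relation $\sim$ on $D$ and $\sim$-invariant relations $R_i^*$ on $D$ with $(D,(R_i^*)_i)/{\sim}\cong\mathcal A$, such that $D$, $\sim$, $\not\sim$ and all $R_i^*$, $\neg R_i^*$ (complements taken in powers of $D$) are defined by a computable sequence of generalized computable $\Sigma_1$ formulas without parameters. Proposition. Suppose $\mathcal A$ is effectively defined in $\mathcal B$ with parameters $\bar b$. For $\bar c$ in the orbit of $\bar b$, let $\mathcal A_{\bar c}$ be the copy of $\mathcal A$ defined by the same formulas with parameters $\bar c$ replacing $\bar b$. Suppose that 1. the orbit of $\bar b$ is defined by a computable $\Sigma_1$ formula $\varphi(\bar u)$; 2. there is a generalized computable $\Sigma_1$ formula $\psi(\bar u,\bar v,\bar x,\bar y)$ such that for all $\bar c,\bar d$ in the orbit of $\bar b$, the formula $\psi(\bar c,\bar d,\bar x,\bar y)$ defines (the graph of) an isomorphism $f_{\bar c,\bar d}$ from $\mathcal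 A_{\bar c}$ onto $\mathcal A_{\bar d}$; 3. this family preserves identity and composition: $f_{\bar c,\bar c}=\mathrm{id}$ and $f_{\bar d,\bar e}\circ f_{\bar c,\bar d}=f_{\bar c,\bar e}$ for all $\bar c,\bar d,\bar e$ in the orbit of $\bar b$. Then $\mathcal A$ is effectively interpreted in $\mathcal B$ without parameters. -/

import Mathlib

open FirstOrder

/-- A computable language: its symbols are identified with natural numbers in such a way that the
sets of function symbols and of relation symbols are computable and the arity of a symbol is
computable from its number. -/
class ComputableLanguage (L : Language) where
  funCode : (Σ n, L.Functions n) → ℕ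
  relCode : (Σ n, L.Relations n) → ℕ
  funCode_injective : Function.Injective funCode
  relCode_injective : Function.Injective relCode
  computable_fun : ComputablePred fun s : ℕ => s ∈ Set.range funCode
  computable_rel : ComputablePred fun s : ℕ => s ∈ Set.range relCode
  computable_funArity : ∃ a : ℕ → ℕ, Computable a ∧ ∀ f, a (funCode f) = f.1
  computable_relArity : ∃ a : ℕ → ℕ, Computable a ∧ ∀ R, a (relCode R) = R.1

/-- The set `B^{<ω}` of all finite tuples from `B` (including the empty tuple). -/
abbrev Tuple (B : Type*) := Σ n : ℕ, (Fin n → B)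

/-- The variables of a formula in `k` tuple variables, the `p`-th of which has length `n p`:
`⟨p, q⟩` is the `q`-th entry of the `p`-th tuple. -/
abbrev TupleVar {k : ℕ} (n : Fin k → ℕ) := Σ p : Fin k, Fin (n p)

/-! ### Gödel numbering of finitary formulas (Polish notation) -/

/-- The letters of the alphabet in which formulas are written; the first component is the kind. -/
abbrev Token := ℕ × ℕ × ℕ

/-- The `q`-th entry of the `p`-th free tuple variable. -/
def Token.free (p q : ℕ) : Token := (0, p, q)

/-- The `r`-th bound variable. -/
def Token.bound (r : ℕ) : Token := (1, r, 0)

/-- The function symbol with number `s`. -/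
def Token.func (s : ℕ) : Token := (2, s, 0)

/-- The relation symbol with number `s`. -/
def Token.rel (s : ℕ) : Token := (3, s, 0)

/-- The logical symbols `⊥`, `=`, `→`, `∀`, numbered `0`, `1`, `2`, `3`. -/
def Token.logic (s : ℕ) : Token := (4, s, 0)

section Coding

variable {L : Language} [ComputableLanguage L] {k : ℕ} {n : Fin k → ℕ}

/-- The letter for a variable or function symbol. -/
def termToken {m : ℕ} : (TupleVar n ⊕ Fin m) ⊕ (Σ i, L.Functions i) → Token
  | Sum.inl (Sum.inl v) => Token.free v.1 v.2
  | Sum.inl (Sum.inr r) => Token.bound r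
  | Sum.inr f => Token.func (ComputableLanguage.funCode f)

/-- A term in Polish notation. -/
def termCode {m : ℕ} (t : L.Term (TupleVar n ⊕ Fin m)) : List Token :=
  t.listEncode.map termToken

/-- A finitary formula in Polish notation. -/
def formulaCode : {m : ℕ} → L.BoundedFormula (TupleVar n) m → List Token
  | _, .falsum => [Token.logic 0]
  | _, .equal t₁ t₂ => Token.logic 1 :: (termCode t₁ ++ termCode t₂)
  | _, .rel (l := l) R ts =>
      Token.rel (ComputableLanguage.relCode ⟨l, R⟩) ::
        (List.ofFn fun p => termCode (ts p)).flatten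
  | _, .imp θ₁ θ₂ => Token.logic 2 :: (formulaCode θ₁ ++ formulaCode θ₂)
  | _, .all θ => Token.logic 3 :: formulaCode θ

end Coding

/-! ### Computable `Σ₁` formulas -/

/-- A disjunct `∃ y₀ … y_{m-1} θ` with `θ` finitary and quantifier-free; the free variables are
indexed by `α`. -/
abbrev Disjunct (L : Language) (α : Type*) :=
  Σ m : ℕ, {θ : L.BoundedFormula α m // θ.IsQF}

/-- A countable disjunction of disjuncts `∃ y₀ … y_{m-1} θ`, presented as a list
(the value `none` contributes no disjunct). -/
abbrev SigmaOne (L : Language) (α : Type*) := ℕ → Option (Disjunct L α)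

/-- Satisfaction of a `Σ₁` formula under an assignment of its free variables. -/
def SigmaOne.Realize {L : Language} {α : Type*} {M : Type*} [L.Structure M]
    (φ : SigmaOne L α) (v : α → M) : Prop :=
  ∃ j, ∃ d ∈ φ j, ∃ y : Fin d.1 → M, d.2.1.Realize v y

/-- The list of the codes of the disjuncts of a `Σ₁` formula. -/
def SigmaOne.codes {L : Language} [ComputableLanguage L] {k : ℕ} {n : Fin k → ℕ}
    (φ : SigmaOne L (TupleVar n)) (j : ℕ) : Option (ℕ × List Token) :=
  (φ j).map fun d => (d.1, formulaCode d.2.1)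

/-- A computable `Σ₁` formula: the disjuncts are computably enumerated. -/
def SigmaOne.IsComputable {L : Language} [ComputableLanguage L] {k : ℕ} {n : Fin k → ℕ}
    (φ : SigmaOne L (TupleVar n)) : Prop :=
  Computable φ.codes

/-- A generalized `Σ₁` formula in `k` tuple variables: one `Σ₁` formula for each choice of the
lengths of the `k` tuples. -/
abbrev GenSigmaOne (L : Language) (k : ℕ) := (n : Fin k → ℕ) → SigmaOne L (TupleVar n)

/-- Satisfaction of a generalized `Σ₁` formula by `k` tuples: these satisfy the formula for their
lengths. -/
def GenSigmaOne.Holds {L : Language} {k : ℕ} {B : Type*} [L.Structure B]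
    (φ : GenSigmaOne L k) (xs : Fin k → Tuple B) : Prop :=
  (φ fun p => (xs p).1).Realize fun v => (xs v.1).2 v.2

/-- A (uniformly) computable sequence of generalized computable `Σ₁` formulas `Φ i`, where the
index `i` has the number `key i` and `Φ i` has `k i` tuple variables: from (the number of) `i` and
the lengths of the tuples one can compute an enumeration of the disjuncts. -/
def IsComputableSeq {L : Language} [ComputableLanguage L] {ι : Type*} (key : ι → ℕ) {k : ι → ℕ}
    (Φ : ∀ i, GenSigmaOne L (k i)) : Prop :=
  ∃ g : ℕ × List ℕ × ℕ → Option (ℕ × List Token), Computable g ∧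
    ∀ (i : ι) (n : Fin (k i) → ℕ) (j : ℕ), g (key i, List.ofFn n, j) = (Φ i n).codes j

/-- A generalized computable `Σ₁` formula. -/
def GenSigmaOne.IsComputable {L : Language} [ComputableLanguage L] {k : ℕ}
    (φ : GenSigmaOne L k) : Prop :=
  IsComputableSeq (fun _ : Unit => 0) fun _ : Unit => φ

/-! ### Effective definitions with parameters -/

/-- A uniformly computable sequence of generalized computable `Σ₁` formulas `D(u; x)` and
`± R(u; x₁, …, x_k)`, for the relation symbols `R` of `L'`.  The first tuple variable `u` is for
the parameters. -/
structure DefiningFormulas (L L' : Language) [ComputableLanguage L] [ComputableLanguage L'] where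
  dom : GenSigmaOne L 2
  pos : ∀ R : (Σ n, L'.Relations n), GenSigmaOne L (R.1 + 1)
  neg : ∀ R : (Σ n, L'.Relations n), GenSigmaOne L (R.1 + 1)
  dom_computable : dom.IsComputable
  pos_computable : IsComputableSeq ComputableLanguage.relCode pos
  neg_computable : IsComputableSeq ComputableLanguage.relCode neg

section Definitions

variable {L L' : Language} [ComputableLanguage L] [ComputableLanguage L']
  {B : Type*} [L.Structure B]

/-- The set `D(c)` defined with parameters `c`. -/
def DefiningFormulas.Domain (S : DefiningFormulas L L') (c : Tuple B) : Set (Tuple B) :=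
  {x | S.dom.Holds ![c, x]}

/-- The structure with universe `D(c)` and relations `R(c)` defined with parameters `c`. -/
instance DefiningFormulas.structure [L'.IsRelational] (S : DefiningFormulas L L') (c : Tuple B) :
    L'.Structure (S.Domain c) where
  funMap f _ := isEmptyElim f
  RelMap {k} R xs :=
    (S.pos ⟨k, R⟩).Holds (Fin.cons (α := fun _ => Tuple B) c fun p => (xs p : Tuple B))

/-- The formulas effectively define the structure `A` in `B` with parameters `b`: for each relation
symbol `R` of arity `k`, `R(b)` is a subset of `D(b)^k`, `¬ R(b)` is its complement in `D(b)^k`, and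
`D(b)` with the relations `R(b)` is a copy of `A`. -/
def DefiningFormulas.EffectivelyDefine [L'.IsRelational] (S : DefiningFormulas L L')
    (A : Type*) [L'.Structure A] (b : Tuple B) : Prop :=
  (∀ (R : Σ n, L'.Relations n) (xs : Fin R.1 → Tuple B),
    ((S.pos R).Holds (Fin.cons (α := fun _ => Tuple B) b xs) → ∀ p, xs p ∈ S.Domain b) ∧
    ((S.neg R).Holds (Fin.cons (α := fun _ => Tuple B) b xs) ↔
      (∀ p, xs p ∈ S.Domain b) ∧
        ¬ (S.pos R).Holds (Fin.cons (α := fun _ => Tuple B) b xs))) ∧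
  Nonempty (A ≃[L'] S.Domain b)

end Definitions

/-- The orbit of a tuple under the automorphisms of the structure. -/
def autOrbit (L : Language) {B : Type*} [L.Structure B] {l : ℕ} (b : Fin l → B) :
    Set (Fin l → B) :=
  {c | ∃ g : B ≃[L] B, c = fun p => g (b p)}

/-! ### Effective interpretations without parameters -/

/-- The relational structure `A` is effectively interpreted in `B` without parameters: there are a
set `D` of finite tuples from `B`, an equivalence relation `∼` on `D` and relations `R*` on `D`,
invariant under `∼`, such that the quotient of `(D, (R*))` by `∼` is isomorphic to `A` and `D`,
`± ∼`, `± R*` are defined by a computable sequence of generalized computable `Σ₁` formulas. -/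
def EffectivelyInterpreted (L L' : Language) [ComputableLanguage L] [ComputableLanguage L']
    (A : Type*) [L'.Structure A] (B : Type*) [L.Structure B] : Prop :=
  ∃ (D : Set (Tuple B)) (s : Setoid D) (_ : L'.Prestructure s),
    Nonempty (A ≃[L'] Quotient s) ∧
    (∃ dom : GenSigmaOne L 1, dom.IsComputable ∧ ∀ x : Tuple B, dom.Holds ![x] ↔ x ∈ D) ∧
    (∃ eqv : GenSigmaOne L 2, eqv.IsComputable ∧
      ∀ x y : Tuple B, eqv.Holds ![x, y] ↔ ∃ (hx : x ∈ D) (hy : y ∈ D), s ⟨x, hx⟩ ⟨y, hy⟩) ∧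
    (∃ neqv : GenSigmaOne L 2, neqv.IsComputable ∧
      ∀ x y : Tuple B, neqv.Holds ![x, y] ↔ ∃ (hx : x ∈ D) (hy : y ∈ D), ¬ s ⟨x, hx⟩ ⟨y, hy⟩) ∧
    (∃ pos : ∀ R : (Σ n, L'.Relations n), GenSigmaOne L R.1,
      IsComputableSeq ComputableLanguage.relCode pos ∧
      ∀ (R : Σ n, L'.Relations n) (xs : Fin R.1 → Tuple B),
        (pos R).Holds xs ↔ ∃ h : ∀ p, xs p ∈ D,
          (Language.Prestructure.toStructure s).RelMap R.2 fun p => (⟨xs p, h p⟩ : D)) ∧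
    (∃ neg : ∀ R : (Σ n, L'.Relations n), GenSigmaOne L R.1,
      IsComputableSeq ComputableLanguage.relCode neg ∧
      ∀ (R : Σ n, L'.Relations n) (xs : Fin R.1 → Tuple B),
        (neg R).Holds xs ↔ ∃ h : ∀ p, xs p ∈ D,
          ¬ (Language.Prestructure.toStructure s).RelMap R.2 fun p => (⟨xs p, h p⟩ : D))

/-!
The interpretation consists of the pairs `(c, y)` with `c` in the orbit of `b` and `y` in the copy
`A_c`, coded by the concatenation of `c` and `y`; two pairs `(c, y)`, `(d, z)` are equivalent if
`f_{c,d} y = z`. Since the isomorphisms compose, `f_{c,b}` followed by an isomorphism `A_b ≅ A`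
gives maps `A_c → A` that are compatible with all `f_{c,d}`. They fit together to a surjection from
the set of pairs onto `A`, whose kernel is the equivalence and along which the relations of `A` are
pulled back.

A relation between pairs holds if and only if some common parameters `d` in the orbit and some
elements `z_p` of `A_d` equivalent to the given pairs satisfy the corresponding formula with
parameters `d`. For the equivalence this formula is `f_{d,d} z₁ = z₂`, and for its complement it is
`z₁ ≠ z₂`. All these conditions are `Σ₁`, uniformly, because generalized computable `Σ₁` formulas
are closed under conjunctions, computable disjunctions and existential quantification over tuples of
arbitrary length.
-/

/-! ### Operations on disjuncts -/

section QuantifierFree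

variable {L : Language} {α β : Type*}

theorem realize_castLE_of_isQF {M : Type*} [L.Structure M] {m N : ℕ} (h : m ≤ N)
    {θ : L.BoundedFormula α m} (hθ : θ.IsQF) (v : α → M) (y : Fin N → M) :
    (θ.castLE h).Realize v y ↔ θ.Realize v (y ∘ Fin.castLE h) := by
  have hy : Sum.elim v y ∘ Sum.map id (Fin.castLE h) = Sum.elim v (y ∘ Fin.castLE h) := by
    simp only [Sum.elim_comp_map, Function.comp_id]
  induction hθ with
  | falsum => exact Iff.rfl
  | of_isAtomic hθ =>
    cases hθ <;> simp only [Language.Term.bdEqual, Language.Relations.boundedFormula,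
      Language.BoundedFormula.castLE, Language.BoundedFormula.Realize, Function.comp_apply,
      Language.Term.realize_relabel, hy]
  | imp _ _ ih₁ ih₂ =>
    simp only [Language.BoundedFormula.castLE, Language.BoundedFormula.realize_imp, ih₁, ih₂]

theorem listEncode_relabel (g : α → β) (t : L.Term α) :
    (t.relabel g).listEncode = t.listEncode.map (Sum.map g id) := by
  induction t with
  | var => rfl
  | func f ts ih =>
    simp only [Language.Term.relabel, Language.Term.listEncode, List.map_cons, Sum.map_inr, id,
      List.map_flatMap, ih]

end QuantifierFree

namespace Disjunct

variable {L : Language} {α β : Type*} {B : Type*} [L.Structure B]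

/-- Satisfaction of a disjunct under an assignment of its free variables. -/
def Realize (d : Disjunct L α) (v : α → B) : Prop :=
  ∃ y : Fin d.1 → B, d.2.1.Realize v y

/-- The valid disjunct. -/
def top : Disjunct L α := ⟨0, ⊤, Language.BoundedFormula.IsQF.top⟩

theorem realize_top (v : α → B) : (top : Disjunct L α).Realize v :=
  ⟨Fin.elim0, Language.BoundedFormula.realize_top.2 trivial⟩

/-- The conjunction of a disjunct with a substitution instance of another one, in prenex form. -/
def andSubst (d : Disjunct L α) (d' : Disjunct L β) (σ : β → α) : Disjunct L α :=
  ⟨d.1 + d'.1,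
    d.2.1.castLE (Nat.le_add_right _ _) ⊓
      d'.2.1.relabel fun x => (Sum.inl (σ x) : α ⊕ Fin d.1),
    d.2.2.castLE.inf (d'.2.2.relabel _)⟩

theorem realize_andSubst (d : Disjunct L α) (d' : Disjunct L β) (σ : β → α) (v : α → B) :
    (d.andSubst d' σ).Realize v ↔ d.Realize v ∧ d'.Realize (v ∘ σ) := by
  have split (y : Fin (d.1 + d'.1) → B) : (d.andSubst d' σ).2.1.Realize v y ↔
      d.2.1.Realize v (y ∘ Fin.castAdd d'.1) ∧ d'.2.1.Realize (v ∘ σ) (y ∘ Fin.natAdd d.1) := by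
    simp only [andSubst, Language.BoundedFormula.realize_inf,
      realize_castLE_of_isQF _ d.2.2, Language.BoundedFormula.realize_relabel]
    rfl
  refine (exists_congr split).trans ⟨?_, ?_⟩
  · rintro ⟨y, hd, hd'⟩
    exact ⟨⟨_, hd⟩, ⟨_, hd'⟩⟩
  · rintro ⟨⟨y, hd⟩, ⟨y', hd'⟩⟩
    refine ⟨Fin.append y y', ?_, ?_⟩
    · simpa only [Function.comp_def, Fin.append_left] using hd
    · simpa only [Function.comp_def, Fin.append_right] using hd'

/-- Existential quantification of the free variables that `σ` sends to `Sum.inr`. -/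
def ex {M : ℕ} (d : Disjunct L β) (σ : β → α ⊕ Fin M) : Disjunct L α :=
  ⟨M + d.1, d.2.1.relabel σ, d.2.2.relabel σ⟩

theorem realize_ex {M : ℕ} (d : Disjunct L β) (σ : β → α ⊕ Fin M) (v : α → B) :
    (d.ex σ).Realize v ↔ ∃ w : Fin M → B, d.Realize (Sum.elim v w ∘ σ) := by
  simp only [Realize, ex, Language.BoundedFormula.realize_relabel]
  constructor
  · rintro ⟨y, hd⟩
    exact ⟨_, _, hd⟩
  · rintro ⟨w, y, hd⟩
    refine ⟨Fin.append w y, ?_⟩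
    simpa only [Function.comp_def, Fin.append_left, Fin.append_right] using hd

end Disjunct

section Codes

/-- The letter for a variable. -/
def varToken {k m : ℕ} {n : Fin k → ℕ} : TupleVar n ⊕ Fin m → Token :=
  Sum.elim (fun v => Token.free v.1 v.2) fun r => Token.bound r

/-- The effect on letters of substituting the variable with letter `f p q` for the `q`-th entry of
the `p`-th free tuple variable and making room for `N` further bound variables. -/
def Token.subst (N : ℕ) (f : ℕ → ℕ → Token) : Token → Token
  | (0, p, q) => f p q
  | (1, r, _) => Token.bound (N + r)
  | t => t

variable {L : Language} [ComputableLanguage L] {k k' : ℕ} {n : Fin k → ℕ} {n' : Fin k' → ℕ}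

theorem formulaCode_castLE {m N : ℕ} (h : m ≤ N) {θ : L.BoundedFormula (TupleVar n) m}
    (hθ : θ.IsQF) : formulaCode (θ.castLE h) = formulaCode θ := by
  have hterm (t : L.Term (TupleVar n ⊕ Fin m)) :
      termCode (t.relabel (Sum.map id (Fin.castLE h))) = termCode t := by
    simp only [termCode, listEncode_relabel, List.map_map]
    refine List.map_congr_left fun x _ => ?_
    rcases x with (v | r) | f <;> rfl
  induction hθ with
  | falsum => rfl
  | of_isAtomic hθ =>
    cases hθ <;> simp only [Language.Term.bdEqual, Language.Relations.boundedFormula,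
      Language.BoundedFormula.castLE, formulaCode, Function.comp_apply, hterm]
  | imp _ _ ih₁ ih₂ => simp only [Language.BoundedFormula.castLE, formulaCode, ih₁, ih₂]

theorem formulaCode_relabel {m N : ℕ} (σ : TupleVar n → TupleVar n' ⊕ Fin N) (f : ℕ → ℕ → Token)
    (hf : ∀ v, f v.1 v.2 = varToken (σ v)) {θ : L.BoundedFormula (TupleVar n) m} (hθ : θ.IsQF) :
    formulaCode (θ.relabel σ) = (formulaCode θ).map (Token.subst N f) := by
  have hterm (t : L.Term (TupleVar n ⊕ Fin m)) :
      termCode (t.relabel (Language.BoundedFormula.relabelAux σ m)) =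
        (termCode t).map (Token.subst N f) := by
    simp only [termCode, listEncode_relabel, List.map_map]
    refine List.map_congr_left fun x _ => ?_
    rcases x with (v | r) | s
    · refine Eq.trans ?_ (hf v).symm
      rcases h : σ v with v' | r <;>
        simp [Language.BoundedFormula.relabelAux, h, varToken, termToken]
    · simp [Language.BoundedFormula.relabelAux, termToken, Token.bound, Token.subst]
    · rfl
  induction hθ with
  | falsum => rfl
  | of_isAtomic hθ =>
    cases hθ with
    | equal t₁ t₂ =>
      simp only [Language.Term.bdEqual, Language.BoundedFormula.relabel,
        Language.BoundedFormula.mapTermRel, formulaCode, hterm, List.map_cons, List.map_append]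
      rfl
    | rel R ts =>
      simp only [Language.Relations.boundedFormula, Language.BoundedFormula.relabel,
        Language.BoundedFormula.mapTermRel, formulaCode, hterm, List.map_cons, List.map_flatten,
        List.map_ofFn]
      rfl
  | imp _ _ ih₁ ih₂ =>
    simp only [Language.BoundedFormula.relabel_imp, formulaCode, ih₁, ih₂, List.map_cons,
      List.map_append]
    rfl

theorem formulaCode_inf {m : ℕ} (θ₁ θ₂ : L.BoundedFormula (TupleVar n) m) :
    formulaCode (θ₁ ⊓ θ₂) = Token.logic 2 :: Token.logic 2 :: (formulaCode θ₁ ++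
      Token.logic 2 :: (formulaCode θ₂ ++ [Token.logic 0, Token.logic 0])) := by
  change formulaCode ((θ₁.imp (θ₂.imp .falsum)).imp .falsum) = _
  simp only [formulaCode, List.append_assoc, List.cons_append, List.nil_append]

/-- The code of a disjunct: the number of its quantifiers and the code of its matrix. -/
def Disjunct.code (d : Disjunct L (TupleVar n)) : ℕ × List Token := (d.1, formulaCode d.2.1)

/-- `Disjunct.andSubst` in terms of codes; `f p q` is the letter of the variable substituted for
the `q`-th entry of the `p`-th tuple variable. -/
def andSubstCode (d d' : ℕ × List Token) (f : ℕ → ℕ → Token) : ℕ × List Token :=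
  (d.1 + d'.1, Token.logic 2 :: Token.logic 2 :: (d.2 ++
    Token.logic 2 :: (d'.2.map (Token.subst d.1 f) ++ [Token.logic 0, Token.logic 0])))

theorem Disjunct.code_andSubst (d : Disjunct L (TupleVar n)) (d' : Disjunct L (TupleVar n'))
    (σ : TupleVar n' → TupleVar n) (f : ℕ → ℕ → Token)
    (hf : ∀ v, f v.1 v.2 = Token.free (σ v).1 (σ v).2) :
    (d.andSubst d' σ).code = andSubstCode d.code d'.code f := by
  simp only [code, andSubst, andSubstCode, formulaCode_inf, formulaCode_castLE _ d.2.2,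
    formulaCode_relabel (fun v => Sum.inl (σ v)) f hf d'.2.2]

theorem Disjunct.code_ex {M : ℕ} (d : Disjunct L (TupleVar n'))
    (σ : TupleVar n' → TupleVar n ⊕ Fin M) (f : ℕ → ℕ → Token)
    (hf : ∀ v, f v.1 v.2 = varToken (σ v)) :
    (d.ex σ).code = (M + d.code.1, d.code.2.map (Token.subst M f)) := by
  simp only [code, ex, formulaCode_relabel σ f hf d.2.2]

end Codes

/-! ### Disjunctions and quantification of tuples -/

section Tuples

variable {B : Type*}

/-- A list regarded as a finite tuple. -/
def tupleOf (xs : List B) : Tuple B := ⟨xs.length, xs.get⟩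

theorem tupleOf_ofFn (x : Tuple B) : tupleOf (List.ofFn x.2) = x :=
  List.equivSigmaTuple.right_inv x

end Tuples

section Computability

theorem foldl_eq_natRec {β σ : Type*} (f : σ → β → σ) (start : σ) (l : List β) :
    l.foldl f start =
      Nat.rec start (fun m s => Option.casesOn l[m]? s fun b => f s b) l.length := by
  suffices h : ∀ m ≤ l.length, (l.take m).foldl f start =
      Nat.rec start (fun m s => Option.casesOn l[m]? s fun b => f s b) m by
    simpa only [List.take_length] using h l.length le_rfl
  intro m hm
  induction m with
  | zero => rfl
  | succ m ih =>
    rw [List.take_succ_eq_append_getElem hm, List.foldl_concat, ih (by lia)]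
    simp only [List.getElem?_eq_getElem (Nat.lt_of_succ_le hm)]

theorem computable_list_foldl {α β σ : Type*} [Primcodable α] [Primcodable β] [Primcodable σ]
    {xs : α → List β} {start : α → σ} {step : α → σ × β → σ}
    (hxs : Computable xs) (hstart : Computable start) (hstep : Computable₂ step) :
    Computable fun a => (xs a).foldl (fun s b => step a (s, b)) (start a) := by
  refine (Computable.nat_rec (Computable.list_length.comp hxs) hstart
    (h := fun a c => Option.casesOn (xs a)[c.1]? c.2 fun b => step a (c.2, b)) ?_).of_eq
    fun a => (foldl_eq_natRec (fun s b => step a (s, b)) _ _).symm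
  exact Computable.option_casesOn
    (Computable.list_getElem?.comp (hxs.comp .fst) (Computable.fst.comp .snd))
    (Computable.snd.comp .snd)
    (hstep.comp (Computable.fst.comp .fst)
      ((Computable.snd.comp (Computable.snd.comp .fst)).pair .snd))

theorem primrec_tokenSubst {α : Type*} [Primcodable α] {N : α → ℕ} {f : α → ℕ → ℕ → Token}
    {t : α → Token} (hN : Primrec N) (hf : Primrec fun x : α × ℕ × ℕ => f x.1 x.2.1 x.2.2)
    (ht : Primrec t) : Primrec fun a => Token.subst (N a) (f a) (t a) := by
  have kind : Primrec fun a => (t a).1 := Primrec.fst.comp ht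
  have args : Primrec fun a => (t a).2 := Primrec.snd.comp ht
  have bound : Primrec fun a => Token.bound (N a + (t a).2.1) :=
    (Primrec.const 1).pair
      ((Primrec.nat_add.comp hN (Primrec.fst.comp args)).pair (Primrec.const 0))
  refine (Primrec.ite (Primrec.eq.comp kind (.const 0)) (hf.comp (Primrec.id.pair args))
    (Primrec.ite (Primrec.eq.comp kind (.const 1)) bound ht)).of_eq fun a => ?_
  rcases t a with ⟨_ | _ | _, _, _⟩ <;> rfl

theorem primrec_tokenFree : Primrec₂ Token.free :=
  (Primrec.const 0).pair Primrec.id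

theorem primrec_andSubstCode {α : Type*} [Primcodable α] {d d' : α → ℕ × List Token}
    {f : α → ℕ → ℕ → Token} (hd : Primrec d) (hd' : Primrec d')
    (hf : Primrec fun x : α × ℕ × ℕ => f x.1 x.2.1 x.2.2) :
    Primrec fun a => andSubstCode (d a) (d' a) (f a) := by
  have hsubst : Primrec fun a => (d' a).2.map (Token.subst (d a).1 (f a)) :=
    Primrec.list_map (Primrec.snd.comp hd') (primrec_tokenSubst (Primrec.fst.comp (hd.comp .fst))
      (hf.comp ((Primrec.fst.comp .fst).pair .snd)) .snd)
  exact (Primrec.nat_add.comp (Primrec.fst.comp hd) (Primrec.fst.comp hd')).pair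
    (Primrec.list_cons.comp (.const _) (Primrec.list_cons.comp (.const _)
      (Primrec.list_append.comp (Primrec.snd.comp hd) (Primrec.list_cons.comp (.const _)
        (Primrec.list_append.comp hsubst (.const _))))))

end Computability

section Closure

variable {L : Language} {k : ℕ} {B : Type*} [L.Structure B]

theorem GenSigmaOne.holds_congr (φ : GenSigmaOne L k) {n : Fin k → ℕ} {v : TupleVar n → B}
    {xs : Fin k → Tuple B} (h : ∀ p, xs p = ⟨n p, fun q => v ⟨p, q⟩⟩) :
    φ.Holds xs ↔ (φ n).Realize v := by
  obtain rfl : xs = fun p => ⟨n p, fun q => v ⟨p, q⟩⟩ := funext h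
  rfl

/-- The disjunction of countably many generalized `Σ₁` formulas. -/
def GenSigmaOne.iSup {β : Type*} [Denumerable β] (Φ : β → GenSigmaOne L k) : GenSigmaOne L k :=
  fun n j => Φ (Denumerable.ofNat β j.unpair.1) n j.unpair.2

theorem GenSigmaOne.holds_iSup {β : Type*} [Denumerable β] (Φ : β → GenSigmaOne L k)
    (xs : Fin k → Tuple B) : (iSup Φ).Holds xs ↔ ∃ e, (Φ e).Holds xs := by
  constructor
  · rintro ⟨j, h⟩
    exact ⟨_, _, h⟩
  · rintro ⟨e, j, h⟩
    refine ⟨Nat.pair (Encodable.encode e) j, ?_⟩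
    simpa only [iSup, Nat.unpair_pair, Denumerable.ofNat_encode] using h

/-- The variables of a formula in `k + 1` tuple variables after quantification of the first one. -/
def quantifyFirst {M : ℕ} {n : Fin k → ℕ} :
    TupleVar (Fin.cons M n : Fin (k + 1) → ℕ) → TupleVar n ⊕ Fin M
  | ⟨p, q⟩ => Fin.cases (motive := fun p => Fin (Fin.cons (α := fun _ => ℕ) M n p) → _)
      Sum.inr (fun p q => Sum.inl ⟨p, q⟩) p q

/-- The quantification of the first tuple variable of a generalized `Σ₁` formula. -/
def GenSigmaOne.ex (φ : GenSigmaOne L (k + 1)) : GenSigmaOne L k := fun n j =>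
  (φ (Fin.cons j.unpair.1 n) j.unpair.2).map fun d => Disjunct.ex d quantifyFirst

theorem GenSigmaOne.ex_pair (φ : GenSigmaOne L (k + 1)) (n : Fin k → ℕ) (M j : ℕ) :
    φ.ex n (Nat.pair M j) =
      (φ (Fin.cons M n) j).map fun d => Disjunct.ex d (quantifyFirst (M := M)) :=
  congrArg (fun c : ℕ × ℕ => (φ (Fin.cons c.1 n) c.2).map fun d =>
    Disjunct.ex d (quantifyFirst (M := c.1))) (Nat.unpair_pair M j)

theorem GenSigmaOne.holds_ex (φ : GenSigmaOne L (k + 1)) (xs : Fin k → Tuple B) :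
    φ.ex.Holds xs ↔ ∃ w : Tuple B, φ.Holds (Fin.cons (α := fun _ => Tuple B) w xs) := by
  have cons_holds (M : ℕ) (w : Fin M → B) :
      φ.Holds (Fin.cons (α := fun _ => Tuple B) ⟨M, w⟩ xs) ↔
        (φ (Fin.cons M fun p => (xs p).1)).Realize
          (Sum.elim (fun v => (xs v.1).2 v.2) w ∘ quantifyFirst) :=
    φ.holds_congr (Fin.cases rfl fun _ => rfl)
  simp only [Sigma.exists, cons_holds]
  constructor
  · rintro ⟨j, d', hd', h⟩
    obtain ⟨d, hd, rfl⟩ := Option.map_eq_some_iff.1 hd'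
    obtain ⟨w, hw⟩ := (Disjunct.realize_ex d _ _).1 h
    exact ⟨_, w, _, d, hd, hw⟩
  · rintro ⟨M, w, j, d, hd, hw⟩
    refine ⟨Nat.pair M j, Disjunct.ex d quantifyFirst, ?_, (Disjunct.realize_ex d _ _).2 ⟨w, hw⟩⟩
    rw [ex_pair]
    exact Option.mem_map_of_mem _ hd

variable [ComputableLanguage L]

theorem IsComputableSeq.iSup {ι β : Type*} [Denumerable β] {key : ι → ℕ} {k : ι → ℕ}
    {Φ : ∀ x : ι × β, GenSigmaOne L (k x.1)}
    (hΦ : IsComputableSeq (fun x : ι × β => Nat.pair (key x.1) (Encodable.encode x.2)) Φ) :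
    IsComputableSeq key fun i => GenSigmaOne.iSup fun e => Φ (i, e) := by
  obtain ⟨g, hg, hgΦ⟩ := hΦ
  have unpair_j : Primrec fun x : ℕ × List ℕ × ℕ => x.2.2.unpair :=
    Primrec.unpair.comp (Primrec.snd.comp .snd)
  refine ⟨fun x => g (Nat.pair x.1 x.2.2.unpair.1, x.2.1, x.2.2.unpair.2),
    hg.comp ((Primrec₂.natPair.comp .fst (Primrec.fst.comp unpair_j)).pair
      ((Primrec.fst.comp .snd).pair (Primrec.snd.comp unpair_j))).to_comp, fun i n j => ?_⟩
  have h := hgΦ (i, Denumerable.ofNat β j.unpair.1) n j.unpair.2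
  simp only [Denumerable.encode_ofNat] at h
  exact h

theorem IsComputableSeq.ex {ι : Type*} {key : ι → ℕ} {k : ι → ℕ}
    {φ : ∀ i, GenSigmaOne L (k i + 1)} (hφ : IsComputableSeq key φ) :
    IsComputableSeq key fun i => (φ i).ex := by
  obtain ⟨g, hg, hgφ⟩ := hφ
  let f : ℕ → ℕ → Token := fun p q => Nat.casesOn p (Token.bound q) fun p => Token.free p q
  have hf : Primrec₂ f := Primrec.nat_casesOn .fst
    ((Primrec.const 1).pair (Primrec.snd.pair (.const 0)))
    (primrec_tokenFree.comp .snd (Primrec.snd.comp .fst))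
  have unpair_j : Primrec fun x : ℕ × List ℕ × ℕ => x.2.2.unpair :=
    Primrec.unpair.comp (Primrec.snd.comp .snd)
  refine ⟨fun x => (g (x.1, x.2.2.unpair.1 :: x.2.1, x.2.2.unpair.2)).map fun d =>
    (x.2.2.unpair.1 + d.1, d.2.map (Token.subst x.2.2.unpair.1 f)), ?_, fun i n j => ?_⟩
  · have hM : Primrec fun x : (ℕ × List ℕ × ℕ) × ℕ × List Token => x.1.2.2.unpair.1 :=
      Primrec.fst.comp (unpair_j.comp .fst)
    refine Computable.option_map (hg.comp (Primrec.fst.pair ((Primrec.list_cons.comp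
      (Primrec.fst.comp unpair_j) (Primrec.fst.comp .snd)).pair
        (Primrec.snd.comp unpair_j))).to_comp) (Primrec.pair ?_ ?_).to_comp
    · exact Primrec.nat_add.comp hM (Primrec.fst.comp .snd)
    · exact Primrec.list_map (Primrec.snd.comp .snd)
        (primrec_tokenSubst (hM.comp .fst)
          (hf.comp (Primrec.fst.comp .snd) (Primrec.snd.comp .snd)) .snd)
  · have code_ex {M : ℕ} (d : Disjunct L (TupleVar (Fin.cons M n : Fin (k i + 1) → ℕ))) :
        (d.ex quantifyFirst).code = (M + d.code.1, d.code.2.map (Token.subst M f)) := by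
      refine d.code_ex _ f ?_
      rintro ⟨p, q⟩
      cases p using Fin.cases <;> rfl
    have h := hgφ i (Fin.cons j.unpair.1 n) j.unpair.2
    rw [List.ofFn_cons] at h
    simp only [h, SigmaOne.codes, GenSigmaOne.ex, Option.map_map]
    congr 1
    exact funext fun d => (code_ex d).symm

end Closure

/-! ### Conjunctions -/

/-- A substitution instance of a member of a sequence of generalized `Σ₁` formulas: the formula
with index `idx`, applied to `k idx` lists of variables. -/
structure Atom {ι : Type*} (k : ι → ℕ) (V : Type*) where
  idx : ι
  args : Fin (k idx) → List V

section Conjunction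

variable {L : Language} {ι : Type*} {k : ι → ℕ} {V B : Type*} [L.Structure B]

/-- The lengths of the tuples of variables to which the formula is applied. -/
def Atom.length (a : Atom k V) (p : Fin (k a.idx)) : ℕ := (a.args p).length

/-- The substitution of variables performed by an atom. -/
def Atom.subst (a : Atom k V) (v : TupleVar a.length) : V := (a.args v.1).get v.2

/-- Satisfaction of a substitution instance, for the interpretation `Φ` of the indices. -/
def Atom.Holds (Φ : ∀ i, GenSigmaOne L (k i)) (a : Atom k V) (v : V → B) : Prop :=
  (Φ a.idx).Holds fun p => tupleOf ((a.args p).map v)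

theorem Atom.holds_iff (Φ : ∀ i, GenSigmaOne L (k i)) (a : Atom k V) (v : V → B) :
    a.Holds Φ v ↔ ∃ j, ∃ d ∈ Φ a.idx a.length j, Disjunct.Realize d (v ∘ a.subst) := by
  refine (Φ a.idx).holds_congr (v := v ∘ a.subst) fun p => ?_
  refine Eq.trans (congrArg tupleOf ?_) (tupleOf_ofFn _)
  refine List.ext_getElem (by simp only [List.length_map, List.length_ofFn, length]) fun q _ _ => ?_
  simp only [List.getElem_map, List.getElem_ofFn]
  rfl

/-- One step in the enumeration of a conjunction of atoms: from a disjunct of the preceding atoms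
and the index `s.2`, which encodes the choice of a disjunct of `a` and of the disjuncts of the
following atoms, to a disjunct of the longer conjunction and the index left for the latter. -/
def conjStep (Φ : ∀ i, GenSigmaOne L (k i)) (s : Option (Disjunct L V) × ℕ) (a : Atom k V) :
    Option (Disjunct L V) × ℕ :=
  (s.1.bind fun d => (Φ a.idx a.length s.2.unpair.1).map fun d' => Disjunct.andSubst d d' a.subst,
    s.2.unpair.2)

/-- The conjunction of a finite list of atoms. -/
def SigmaOne.conj (Φ : ∀ i, GenSigmaOne L (k i)) (as : List (Atom k V)) : SigmaOne L V := fun j =>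
  (as.foldl (conjStep Φ) (some Disjunct.top, j)).1

theorem SigmaOne.realize_conj (Φ : ∀ i, GenSigmaOne L (k i)) (as : List (Atom k V)) (v : V → B) :
    (conj Φ as).Realize v ↔ ∀ a ∈ as, a.Holds Φ v := by
  suffices h : ∀ m, (∃ j d, as.foldl (conjStep Φ) (some Disjunct.top, j) = (some d, m) ∧
      Disjunct.Realize d v) ↔ ∀ a ∈ as, a.Holds Φ v by
    constructor
    · rintro ⟨j, d, hd, hv⟩
      exact (h _).1 ⟨j, d, Prod.ext hd rfl, hv⟩
    · intro has
      obtain ⟨j, d, hd, hv⟩ := (h 0).2 has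
      exact ⟨j, d, congrArg Prod.fst hd, hv⟩
  induction as using List.reverseRecOn with
  | nil =>
    intro m
    exact iff_of_true ⟨m, _, rfl, Disjunct.realize_top v⟩ (List.forall_mem_nil _)
  | append_singleton as a ih =>
    intro m
    simp only [List.foldl_concat, List.forall_mem_append, List.forall_mem_singleton, a.holds_iff]
    constructor
    · rintro ⟨j, d'', h, hv⟩
      obtain ⟨hd'', -⟩ := Prod.ext_iff.1 h
      obtain ⟨d, hd, hd''⟩ := Option.bind_eq_some_iff.1 hd''
      obtain ⟨d', hd', rfl⟩ := Option.map_eq_some_iff.1 hd''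
      rw [Disjunct.realize_andSubst] at hv
      exact ⟨(ih _).1 ⟨j, d, Prod.ext hd rfl, hv.1⟩, _, d', hd', hv.2⟩
    · rintro ⟨has, i, d', hd', hv'⟩
      obtain ⟨j, d, hd, hv⟩ := (ih (Nat.pair i m)).2 has
      refine ⟨j, Disjunct.andSubst d d' a.subst, ?_, (Disjunct.realize_andSubst ..).2 ⟨hv, hv'⟩⟩
      rw [Option.mem_def] at hd'
      simp only [hd, conjStep, Nat.unpair_pair, Option.bind_some, hd', Option.map_some]

end Conjunction

section ConjunctionCode

/-- The letter of the variable which an atom substitutes for the `q`-th entry of the `p`-th tuple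
variable, from the lists of the letters of its arguments. -/
def argToken (args : List (List Token)) (p q : ℕ) : Token :=
  (args.getD p []).getD q (Token.bound 0)

/-- `conjStep` in terms of codes, where `g` computes the codes of the disjuncts of the sequence. -/
def conjStepCode (g : ℕ × List ℕ × ℕ → Option (ℕ × List Token))
    (s : Option (ℕ × List Token) × ℕ) (a : ℕ × List (List Token)) :
    Option (ℕ × List Token) × ℕ :=
  (s.1.bind fun d => (g (a.1, a.2.map List.length, s.2.unpair.1)).map fun d' =>
    andSubstCode d d' (argToken a.2), s.2.unpair.2)

theorem computable_conjStepCode {g : ℕ × List ℕ × ℕ → Option (ℕ × List Token)}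
    (hg : Computable g) : Computable₂ (conjStepCode g) := by
  have hj : Primrec fun x : (Option (ℕ × List Token) × ℕ) × ℕ × List (List Token) =>
      x.1.2.unpair := Primrec.unpair.comp (Primrec.snd.comp .fst)
  refine Computable.pair (Computable.option_bind (Computable.fst.comp .fst)
    (Computable.option_map ?_ ?_)) (Primrec.snd.comp hj).to_comp
  · exact (hg.comp ((Primrec.fst.comp .snd).pair ((Primrec.list_map (Primrec.snd.comp .snd)
      (Primrec.list_length.comp₂ .right)).pair (Primrec.fst.comp hj))).to_comp).comp .fst
  · refine (primrec_andSubstCode (Primrec.snd.comp .fst) .snd ?_).to_comp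
    exact (Primrec.list_getD _).comp ((Primrec.list_getD _).comp
      (Primrec.snd.comp (Primrec.snd.comp (Primrec.fst.comp (Primrec.fst.comp .fst))))
      (Primrec.fst.comp .snd)) (Primrec.snd.comp .snd)

variable {L : Language} [ComputableLanguage L] {ι κ : Type*} {k : ι → ℕ} {k₀ : ℕ} {n : Fin k₀ → ℕ}

/-- The number of the formula and the letters of its arguments. -/
def Atom.code (key : ι → ℕ) (a : Atom k (TupleVar n)) : ℕ × List (List Token) :=
  (key a.idx, List.ofFn fun p => (a.args p).map fun v => Token.free v.1 v.2)

theorem conjStepCode_code {g : ℕ × List ℕ × ℕ → Option (ℕ × List Token)} {key : ι → ℕ}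
    {Φ : ∀ i, GenSigmaOne L (k i)}
    (hgΦ : ∀ (i : ι) (n : Fin (k i) → ℕ) (j : ℕ), g (key i, List.ofFn n, j) = (Φ i n).codes j)
    (s : Option (Disjunct L (TupleVar n)) × ℕ) (a : Atom k (TupleVar n)) :
    conjStepCode g (Prod.map (Option.map Disjunct.code) id s) (a.code key) =
      Prod.map (Option.map Disjunct.code) id (conjStep Φ s a) := by
  have code_andSubst (d : Disjunct L (TupleVar n)) (d' : Disjunct L (TupleVar a.length)) :
      andSubstCode d.code d'.code (argToken (a.code key).2) = (d.andSubst d' a.subst).code :=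
    (d.code_andSubst d' a.subst _ fun v => by
      simp [argToken, Atom.code, Atom.subst, Atom.length, List.getD_eq_getElem?_getD]).symm
  have lengths : (a.code key).2.map List.length = List.ofFn a.length := by
    simp only [Atom.code, List.map_ofFn, Function.comp_def, List.length_map]
    rfl
  obtain ⟨_ | d, j⟩ := s
  · rfl
  · simp only [conjStepCode, lengths, Prod.map, Option.map_some, id, Option.bind_some, conjStep]
    rw [show g ((a.code key).1, _) = _ from hgΦ a.idx a.length _]
    simp only [SigmaOne.codes, Option.map_map]
    congr 2
    exact funext (code_andSubst d)

theorem IsComputableSeq.conj {key : ι → ℕ} {Φ : ∀ i, GenSigmaOne L (k i)}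
    (hΦ : IsComputableSeq key Φ) {key' k' : κ → ℕ}
    {as : ∀ (i : κ) (n : Fin (k' i) → ℕ), List (Atom k (TupleVar n))}
    {h : ℕ × List ℕ → List (ℕ × List (List Token))} (hh : Computable h)
    (has : ∀ (i : κ) (n : Fin (k' i) → ℕ),
      h (key' i, List.ofFn n) = (as i n).map (Atom.code key)) :
    IsComputableSeq key' (k := k') fun i n => SigmaOne.conj Φ (as i n) := by
  obtain ⟨g, hg, hgΦ⟩ := hΦ
  let topCode : ℕ × List Token := (0, [Token.logic 2, Token.logic 0, Token.logic 0])
  have fold_computable : Computable fun x : ℕ × List ℕ × ℕ =>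
      (h (x.1, x.2.1)).foldl (conjStepCode g) (some topCode, x.2.2) :=
    computable_list_foldl (step := fun _ s => conjStepCode g s.1 s.2)
      (hh.comp (Computable.fst.pair (Computable.fst.comp .snd)))
      ((Computable.const _).pair (Computable.snd.comp .snd))
      ((computable_conjStepCode hg).comp (Computable.fst.comp .snd) (Computable.snd.comp .snd))
  refine ⟨_, Computable.fst.comp fold_computable, fun i n j => ?_⟩
  have start : ((some topCode, j) : Option (ℕ × List Token) × ℕ) = Prod.map
      (Option.map Disjunct.code) id (some (Disjunct.top : Disjunct L (TupleVar n)), j) := rfl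
  simp only [has, List.foldl_map, start]
  rw [List.foldl_hom _ fun s a => conjStepCode_code hgΦ s a]
  rfl

end ConjunctionCode

/-! ### Primitive positive formulas -/

section TupleTerms

variable {B : Type*}

/-- The tuple of the first `l` entries of a tuple. -/
def tupleTake (l : ℕ) (x : Tuple B) : Tuple B := tupleOf ((List.ofFn x.2).take l)

/-- The tuple of the entries of a tuple after the first `l` ones. -/
def tupleDrop (l : ℕ) (x : Tuple B) : Tuple B := tupleOf ((List.ofFn x.2).drop l)

/-- The terms for tuples allowed in primitive positive formulas with `k` free and `K` quantified
tuple variables: an initial or final segment of a free tuple, or a quantified tuple. -/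
inductive TupleTerm (k K : ℕ)
  | take (l : ℕ) (p : Fin k)
  | drop (l : ℕ) (p : Fin k)
  | bound (p : Fin K)

variable {k K : ℕ}

/-- The value of a tuple term, for free tuples `xs` and quantified tuples `z`. -/
def TupleTerm.eval (xs : Fin k → Tuple B) (z : Fin K → Tuple B) : TupleTerm k K → Tuple B
  | take l p => tupleTake l (xs p)
  | drop l p => tupleDrop l (xs p)
  | bound p => z p

/-- The entries of a list from position `b.2` to position `b.1`, the latter excluded. -/
def listSlice {α : Type*} (l : List α) (b : ℕ × ℕ) : List α := (l.take b.1).drop b.2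

theorem exists_listSlice_eq (z : Fin K → List B) :
    ∃ (w : List B) (e : List (ℕ × ℕ)), ∀ p : Fin K, listSlice w (e.getD p (0, 0)) = z p := by
  let zs := List.ofFn z
  refine ⟨zs.flatten, List.ofFn fun p : Fin K =>
    (((zs.map List.length).take (p + 1)).sum, ((zs.map List.length).take p).sum), fun p => ?_⟩
  have hp : (p : ℕ) < zs.length := by simp only [zs, List.length_ofFn, p.2]
  simp only [List.getD_eq_getElem?_getD, List.getElem?_ofFn, p.2, dite_true, Option.getD_some]
  exact (List.drop_take_succ_flatten_eq_getElem zs p hp).trans (List.getElem_ofFn hp)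

/-- The list of the entries of a tuple variable. -/
def tupleVarBlock (n : Fin k → ℕ) (p : Fin k) : List (TupleVar n) :=
  (List.finRange (n p)).map (Sigma.mk p)

theorem map_tupleVarBlock (xs : Fin k → Tuple B) (p : Fin k) :
    (tupleVarBlock (fun p => (xs p).1) p).map (fun v => (xs v.1).2 v.2) = List.ofFn (xs p).2 := by
  rw [tupleVarBlock, List.map_map, List.ofFn_eq_map]
  rfl

/-- A tuple term as a list of variables, when the quantified tuples are the slices, with bounds
`e`, of one tuple `w`; this is the tuple variable number `0` and the free ones come after it. -/
def TupleTerm.vars (e : List (ℕ × ℕ)) (n : Fin (k + 1) → ℕ) :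
    TupleTerm k K → List (TupleVar n)
  | take l p => (tupleVarBlock n p.succ).take l
  | drop l p => (tupleVarBlock n p.succ).drop l
  | bound p => listSlice (tupleVarBlock n 0) (e.getD p (0, 0))

theorem TupleTerm.tupleOf_vars (e : List (ℕ × ℕ)) (w : Tuple B) (xs : Fin k → Tuple B)
    (t : TupleTerm k K) :
    let ys : Fin (k + 1) → Tuple B := Fin.cons w xs
    tupleOf ((t.vars e fun p => (ys p).1).map fun v => (ys v.1).2 v.2) =
      t.eval xs fun p => tupleOf (listSlice (List.ofFn w.2) (e.getD p (0, 0))) := by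
  cases t <;>
    simp only [vars, listSlice, List.map_take, List.map_drop, map_tupleVarBlock, eval] <;> rfl

/-- The code of a tuple term. -/
def TupleTerm.code : TupleTerm k K → ℕ × ℕ × ℕ
  | take l p => (0, l, p)
  | drop l p => (1, l, p)
  | bound p => (2, 0, p)

/-- The letters of the entries of the `p`-th tuple variable, for tuple variables of lengths `ns`. -/
def freeBlock (ns : List ℕ) (p : ℕ) : List Token := (List.range (ns.getD p 0)).map (Token.free p)

/-- The letters of `TupleTerm.vars`, from the code of the term. -/
def termLetters (e : List (ℕ × ℕ)) (ns : List ℕ) : ℕ × ℕ × ℕ → List Token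
  | (0, l, p) => (freeBlock ns (p + 1)).take l
  | (1, l, p) => (freeBlock ns (p + 1)).drop l
  | (_, _, p) => listSlice (freeBlock ns 0) (e.getD p (0, 0))

theorem map_free_tupleVarBlock (n : Fin k → ℕ) (p : Fin k) :
    (tupleVarBlock n p).map (fun v => Token.free v.1 v.2) = freeBlock (List.ofFn n) p := by
  have hp : (List.ofFn n).getD p 0 = n p := by simp [List.getD_eq_getElem?_getD]
  rw [tupleVarBlock, freeBlock, hp, ← List.map_coe_finRange_eq_range, List.map_map, List.map_map]
  rfl

theorem TupleTerm.map_free_vars (e : List (ℕ × ℕ)) (n : Fin (k + 1) → ℕ) (t : TupleTerm k K) :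
    (t.vars e n).map (fun v => Token.free v.1 v.2) = termLetters e (List.ofFn n) t.code := by
  cases t <;>
    simp only [vars, code, termLetters, listSlice, List.map_take, List.map_drop,
      map_free_tupleVarBlock, Fin.val_succ, Fin.val_zero]

theorem primrec_freeBlock : Primrec₂ freeBlock :=
  Primrec.list_map (Primrec.list_range.comp ((Primrec.list_getD 0).comp .fst .snd))
    (primrec_tokenFree.comp (Primrec.snd.comp .fst) .snd)

theorem primrec_termLetters :
    Primrec fun x : (List (ℕ × ℕ) × List ℕ) × ℕ × ℕ × ℕ => termLetters x.1.1 x.1.2 x.2 := by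
  have ns : Primrec fun x : (List (ℕ × ℕ) × List ℕ) × ℕ × ℕ × ℕ => x.1.2 :=
    Primrec.snd.comp .fst
  have kind : Primrec fun x : (List (ℕ × ℕ) × List ℕ) × ℕ × ℕ × ℕ => x.2.1 :=
    Primrec.fst.comp .snd
  have length : Primrec fun x : (List (ℕ × ℕ) × List ℕ) × ℕ × ℕ × ℕ => x.2.2.1 :=
    Primrec.fst.comp (Primrec.snd.comp .snd)
  have var : Primrec fun x : (List (ℕ × ℕ) × List ℕ) × ℕ × ℕ × ℕ => x.2.2.2 :=
    Primrec.snd.comp (Primrec.snd.comp .snd)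
  have block := primrec_freeBlock.comp ns (Primrec.succ.comp var)
  have bounds := (Primrec.list_getD (0, 0)).comp (Primrec.fst.comp .fst) var
  refine (Primrec.ite (Primrec.eq.comp kind (.const 0)) (Primrec.list_take.comp length block)
    (Primrec.ite (Primrec.eq.comp kind (.const 1)) (Primrec.list_drop.comp length block)
      (Primrec.list_drop.comp (Primrec.snd.comp bounds) (Primrec.list_take.comp
        (Primrec.fst.comp bounds) (primrec_freeBlock.comp ns (.const 0)))))).of_eq fun x => ?_
  rcases x with ⟨_, _ | _ | _, _, _⟩ <;> rfl

end TupleTerms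

/-- An atomic part of a primitive positive formula over a sequence of generalized `Σ₁` formulas:
the formula with index `idx`, applied to tuple terms. -/
structure TupleAtom {ι : Type*} (k : ι → ℕ) (k₀ K : ℕ) where
  idx : ι
  args : Fin (k idx) → TupleTerm k₀ K

section PrimitivePositive

variable {L : Language} {ι κ : Type*} {k : ι → ℕ} {k₀ K : ℕ} {B : Type*} [L.Structure B]

/-- Satisfaction of an atomic part by free tuples `xs` and quantified tuples `z`. -/
def TupleAtom.Holds (Φ : ∀ i, GenSigmaOne L (k i)) (a : TupleAtom k k₀ K) (xs : Fin k₀ → Tuple B)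
    (z : Fin K → Tuple B) : Prop :=
  (Φ a.idx).Holds fun q => (a.args q).eval xs z

/-- The atom on single variables that corresponds to an atomic part, when the quantified tuples are
encoded as in `TupleTerm.vars`. -/
def TupleAtom.toAtom (e : List (ℕ × ℕ)) (n : Fin (k₀ + 1) → ℕ) (a : TupleAtom k k₀ K) :
    Atom k (TupleVar n) :=
  ⟨a.idx, fun q => (a.args q).vars e n⟩

/-- The primitive positive formula `∃ z₁ … z_K ⋀ as` over a sequence of generalized `Σ₁` formulas.
It is expressed with a single quantified tuple, of which the `z`'s are slices. -/
def GenSigmaOne.primitivePositive (Φ : ∀ i, GenSigmaOne L (k i)) (as : List (TupleAtom k k₀ K)) :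
    GenSigmaOne L k₀ :=
  ex (iSup fun e : List (ℕ × ℕ) => fun n => SigmaOne.conj Φ (as.map (TupleAtom.toAtom e n)))

theorem GenSigmaOne.holds_primitivePositive (Φ : ∀ i, GenSigmaOne L (k i))
    (as : List (TupleAtom k k₀ K)) (xs : Fin k₀ → Tuple B) :
    (primitivePositive Φ as).Holds xs ↔ ∃ z : Fin K → Tuple B, ∀ a ∈ as, a.Holds Φ xs z := by
  have holds_conj (w : Tuple B) (e : List (ℕ × ℕ)) :
      Holds (fun n => SigmaOne.conj Φ (as.map (TupleAtom.toAtom e n)))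
        (Fin.cons (α := fun _ => Tuple B) w xs) ↔ ∀ a ∈ as, a.Holds Φ xs fun p =>
          tupleOf (listSlice (List.ofFn w.2) (e.getD p (0, 0))) := by
    simp only [Holds, SigmaOne.realize_conj, List.forall_mem_map, Atom.Holds, TupleAtom.toAtom]
    exact forall₂_congr fun a _ => iff_of_eq (congrArg (Holds (Φ a.idx))
      (funext fun q => (a.args q).tupleOf_vars e w xs))
  simp only [primitivePositive, holds_ex, holds_iSup, holds_conj]
  constructor
  · rintro ⟨w, e, h⟩
    exact ⟨_, h⟩
  · rintro ⟨z, h⟩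
    obtain ⟨w, e, hw⟩ := exists_listSlice_eq fun p => List.ofFn (z p).2
    have slices_eq : (fun p : Fin K =>
        tupleOf (listSlice (List.ofFn (tupleOf w).2) (e.getD p (0, 0)))) = z := by
      funext p
      rw [show List.ofFn (tupleOf w).2 = w from List.ofFn_get w, hw, tupleOf_ofFn]
    exact ⟨tupleOf w, e, slices_eq ▸ h⟩

/-- The formula `φ(x_{σ 0}, …, x_{σ (m - 1)})`. -/
def GenSigmaOne.reindex {m : ℕ} (φ : GenSigmaOne L m) (σ : Fin m → Fin k₀) : GenSigmaOne L k₀ :=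
  primitivePositive (K := 0) (fun _ : Unit => φ) [⟨(), fun q => .drop 0 (σ q)⟩]

theorem GenSigmaOne.holds_reindex {m : ℕ} (φ : GenSigmaOne L m) (σ : Fin m → Fin k₀)
    (xs : Fin k₀ → Tuple B) : (φ.reindex σ).Holds xs ↔ φ.Holds (xs ∘ σ) := by
  have args_eq : (fun q => tupleDrop 0 (xs (σ q))) = xs ∘ σ := funext fun q => tupleOf_ofFn _
  simp only [reindex, holds_primitivePositive, List.forall_mem_singleton, TupleAtom.Holds,
    TupleTerm.eval, args_eq, exists_const]

variable [ComputableLanguage L]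

/-- The number of the formula and the codes of its arguments. -/
def TupleAtom.code (key : ι → ℕ) (a : TupleAtom k k₀ K) : ℕ × List (ℕ × ℕ × ℕ) :=
  (key a.idx, List.ofFn fun q => (a.args q).code)

theorem IsComputableSeq.primitivePositive {key : ι → ℕ} {Φ : ∀ i, GenSigmaOne L (k i)}
    (hΦ : IsComputableSeq key Φ) {key' k' K : κ → ℕ} {as : ∀ i : κ, List (TupleAtom k (k' i) (K i))}
    {h : ℕ × ℕ → List (ℕ × List (ℕ × ℕ × ℕ))} (hh : Computable h)
    (has : ∀ i, h (key' i, k' i) = (as i).map (TupleAtom.code key)) :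
    IsComputableSeq key' fun i => GenSigmaOne.primitivePositive Φ (as i) := by
  let letters (x : ℕ × List ℕ) : ℕ × ℕ × ℕ → List Token :=
    termLetters ((Encodable.decode (α := List (ℕ × ℕ)) x.1.unpair.2).getD []) x.2
  let conjLetters (x : ℕ × List ℕ) (as : List (ℕ × List (ℕ × ℕ × ℕ))) :
      List (ℕ × List (List Token)) :=
    as.map fun a => (a.1, a.2.map (letters x))
  have conjLetters_primrec : Primrec₂ conjLetters := by
    have hletters : Primrec₂ letters := primrec_termLetters.comp (Primrec.pair
      (Primrec.pair (Primrec.option_getD.comp (Primrec.decode.comp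
        (Primrec.snd.comp (Primrec.unpair.comp (Primrec.fst.comp .fst)))) (.const []))
        (Primrec.snd.comp .fst)) .snd)
    exact Primrec.list_map .snd ((Primrec.fst.comp .snd).pair
      (Primrec.list_map (Primrec.snd.comp .snd)
        (hletters.comp (Primrec.fst.comp (Primrec.fst.comp .fst)) .snd)))
  refine IsComputableSeq.ex (IsComputableSeq.iSup (β := List (ℕ × ℕ)) (k := fun i => k' i + 1)
    (Φ := fun x n => SigmaOne.conj Φ ((as x.1).map (TupleAtom.toAtom x.2 n)))
    (IsComputableSeq.conj hΦ (k' := fun x : κ × List (ℕ × ℕ) => k' x.1 + 1)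
      (as := fun x n => (as x.1).map (TupleAtom.toAtom x.2 n))
      (h := fun x => conjLetters x (h (x.1.unpair.1, x.2.length - 1))) ?_ ?_))
  · exact conjLetters_primrec.to_comp.comp .id (hh.comp (Primrec.pair
      (Primrec.fst.comp (Primrec.unpair.comp .fst))
      (Primrec.pred.comp (Primrec.list_length.comp .snd))).to_comp)
  · rintro ⟨i, e⟩ n
    simp only [conjLetters, letters, Nat.unpair_pair, Encodable.encodek, Option.getD_some,
      List.length_ofFn, Nat.add_sub_cancel, has, List.map_map]
    refine List.map_congr_left fun a _ => ?_
    simp only [Function.comp_apply, Atom.code, TupleAtom.toAtom, TupleAtom.code, List.map_ofFn,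
      TupleTerm.map_free_vars]
    rfl

theorem GenSigmaOne.IsComputable.reindex {m : ℕ} {φ : GenSigmaOne L m} (hφ : φ.IsComputable)
    (σ : Fin m → Fin k₀) : (φ.reindex σ).IsComputable :=
  IsComputableSeq.primitivePositive hφ (k' := fun _ => k₀)
    (Computable.const [(0, List.ofFn fun q => (1, 0, (σ q : ℕ)))]) fun _ => rfl

end PrimitivePositive

section BaseFormulas

variable {L : Language} {k : ℕ} {B : Type*} [L.Structure B]

/-- A `Σ₁` formula about tuples of lengths `n₀`, regarded as a generalized one that no tuples of
other lengths satisfy. -/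
def GenSigmaOne.ofLengths {n₀ : Fin k → ℕ} (φ : SigmaOne L (TupleVar n₀)) : GenSigmaOne L k :=
  fun n => if h : n₀ = n then h ▸ φ else fun _ => none

theorem GenSigmaOne.holds_ofLengths {n₀ : Fin k → ℕ} (φ : SigmaOne L (TupleVar n₀))
    (xs : Fin k → Tuple B) : (ofLengths φ).Holds xs ↔
      ∃ v : TupleVar n₀ → B, (∀ p, xs p = ⟨n₀ p, fun q => v ⟨p, q⟩⟩) ∧ φ.Realize v := by
  constructor
  · intro h
    by_cases hn : n₀ = fun p => (xs p).1
    · subst hn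
      rw [Holds, ofLengths, dif_pos rfl] at h
      exact ⟨_, fun _ => rfl, h⟩
    · obtain ⟨j, d, hd, -⟩ := h
      simp only [ofLengths, dif_neg hn, Option.mem_def, reduceCtorEq] at hd
  · rintro ⟨v, hv, h⟩
    simpa only [holds_congr _ hv, ofLengths, dite_true] using h

theorem GenSigmaOne.holds_ofLengths_singleton {l : ℕ}
    (φ : SigmaOne L (TupleVar fun _ : Fin 1 => l))
    (u : Tuple B) : (ofLengths φ).Holds ![u] ↔
      ∃ c : Fin l → B, u = ⟨l, c⟩ ∧ φ.Realize fun v => c v.2 := by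
  rw [holds_ofLengths]
  constructor
  · rintro ⟨v, hv, h⟩
    refine ⟨fun q => v ⟨0, q⟩, hv 0, ?_⟩
    convert h using 2 with w
    obtain ⟨p, q⟩ := w
    rw [← Subsingleton.elim 0 p]
  · rintro ⟨c, rfl, h⟩
    exact ⟨fun v => c v.2, Fin.forall_fin_one.2 rfl, h⟩

/-- The formula expressing that the `p`-th and the `q`-th tuple are different. Its disjuncts are
`⊤` if they have different lengths; otherwise the `j`-th one says that the `j`-th entries differ. -/
def tupleNe (L : Language) (p q : Fin k) : GenSigmaOne L k := fun n j =>
  if n p = n q then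
    if h : j < n p ∧ j < n q then
      some ⟨0, .imp (.equal (.var (.inl ⟨p, j, h.1⟩)) (.var (.inl ⟨q, j, h.2⟩))) .falsum,
        .imp (.of_isAtomic (.equal _ _)) .falsum⟩
    else none
  else some Disjunct.top

theorem holds_tupleNe (p q : Fin k) (xs : Fin k → Tuple B) :
    (tupleNe L p q).Holds xs ↔ xs p ≠ xs q := by
  by_cases hn : (xs p).1 = (xs q).1
  · have ne_iff : xs p ≠ xs q ↔ ∃ j, ∃ h : j < (xs p).1 ∧ j < (xs q).1,
        (xs p).2 ⟨j, h.1⟩ ≠ (xs q).2 ⟨j, h.2⟩ := by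
      simp only [ne_eq, Fin.sigma_eq_iff_eq_comp_cast, hn, exists_true_left, funext_iff,
        Fin.forall_iff, not_forall, and_self, Function.comp_apply]
      rfl
    rw [ne_iff]
    refine exists_congr fun j => ?_
    rw [tupleNe, if_pos hn]
    split_ifs with h
    · simp only [Option.mem_some_iff, exists_eq_left', exists_prop_of_true h]
      exact ⟨fun ⟨_, hy⟩ => hy, fun hy => ⟨Fin.elim0, hy⟩⟩
    · exact iff_of_false (by rintro ⟨_, ⟨⟩, _⟩) fun ⟨h', _⟩ => h h'
  · exact iff_of_true ⟨0, _, if_neg hn, Disjunct.realize_top _⟩ fun h => hn (congrArg Sigma.fst h)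

variable [ComputableLanguage L]

theorem SigmaOne.IsComputable.ofLengths {n₀ : Fin k → ℕ} {φ : SigmaOne L (TupleVar n₀)}
    (hφ : φ.IsComputable) : (GenSigmaOne.ofLengths φ).IsComputable := by
  refine ⟨fun x => bif x.2.1 = List.ofFn n₀ then φ.codes x.2.2 else none, ?_, fun _ n j => ?_⟩
  · exact Computable.cond (Primrec.eq.comp (Primrec.fst.comp .snd) (.const _)).decide.to_comp
      (hφ.comp (Computable.snd.comp .snd)) (.const none)
  · by_cases hn : n₀ = n
    · subst hn
      simp only [decide_true, cond_true, GenSigmaOne.ofLengths, dite_true]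
    · simp only [List.ofFn_inj, Ne.symm hn, decide_false, cond_false, GenSigmaOne.ofLengths,
        dif_neg hn, SigmaOne.codes, Option.map_none]

theorem isComputable_tupleNe (p q : Fin k) : (tupleNe L p q).IsComputable := by
  let neCode (j : ℕ) : ℕ × List Token :=
    (0, [Token.logic 2, Token.logic 1, Token.free p j, Token.free q j, Token.logic 0])
  have neCode_primrec : Primrec neCode := by
    have hfree (p : ℕ) : Primrec (Token.free p) := primrec_tokenFree.comp (.const p) .id
    exact (Primrec.const 0).pair (Primrec.list_cons.comp (.const _) (Primrec.list_cons.comp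
      (.const _) (Primrec.list_cons.comp (hfree p) (Primrec.list_cons.comp (hfree q) (.const _)))))
  have length (p : ℕ) : Primrec fun x : ℕ × List ℕ × ℕ => x.2.1.getD p 0 :=
    (Primrec.list_getD 0).comp (Primrec.fst.comp .snd) (.const p)
  have j_lt (p : ℕ) : PrimrecPred fun x : ℕ × List ℕ × ℕ => x.2.2 < x.2.1.getD p 0 :=
    Primrec.nat_lt.comp (Primrec.snd.comp .snd) (length p)
  refine ⟨_, (Primrec.ite (Primrec.eq.comp (length p) (length q))
    (Primrec.ite ((j_lt p).and (j_lt q))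
      (Primrec.option_some.comp (neCode_primrec.comp (Primrec.snd.comp .snd))) (.const none))
    (.const (some (0, [Token.logic 2, Token.logic 0, Token.logic 0])))).to_comp, fun _ n j => ?_⟩
  have getD_ofFn (p : Fin k) : (List.ofFn n).getD p 0 = n p := by
    simp [List.getD_eq_getElem?_getD]
  simp only [getD_ofFn, SigmaOne.codes, tupleNe]
  split_ifs <;> rfl

/-- The names of the formulas from which an interpretation without parameters is built: the one
that defines the orbit of the parameters, the one that defines the isomorphisms, and the formulas
with parameters for the given relations. -/
inductive BaseFormula (ι : Type*)
  | orbit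
  | iso
  | rel (i : ι)

namespace BaseFormula

variable {ι : Type*} {r : ι → ℕ} {key : ι → ℕ}

/-- The number of a name. -/
def number (key : ι → ℕ) : BaseFormula ι → ℕ
  | orbit => 0
  | iso => 1
  | rel i => key i + 2

/-- The number of tuple variables of the named formula. -/
def arity (r : ι → ℕ) : BaseFormula ι → ℕ
  | orbit => 1
  | iso => 4
  | rel i => r i + 1

/-- The named formula. -/
def formula (φ : GenSigmaOne L 1) (ψ : GenSigmaOne L 4) (P : ∀ i, GenSigmaOne L (r i + 1)) :
    ∀ s : BaseFormula ι, GenSigmaOne L (s.arity r)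
  | orbit => φ
  | iso => ψ
  | rel i => P i

theorem isComputableSeq_formula {φ : GenSigmaOne L 1} (hφ : φ.IsComputable)
    {ψ : GenSigmaOne L 4} (hψ : ψ.IsComputable) {P : ∀ i, GenSigmaOne L (r i + 1)}
    (hP : IsComputableSeq key P) : IsComputableSeq (number key) (formula φ ψ P) := by
  obtain ⟨gφ, hgφ, hφ⟩ := hφ
  obtain ⟨gψ, hgψ, hψ⟩ := hψ
  obtain ⟨gP, hgP, hP⟩ := hP
  refine ⟨fun x => Nat.casesOn x.1 (gφ (0, x.2)) fun s =>
    Nat.casesOn s (gψ (0, x.2)) fun s => gP (s, x.2), ?_, ?_⟩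
  · exact Computable.nat_casesOn .fst (hgφ.comp ((Computable.const 0).pair .snd))
      (Computable.nat_casesOn .snd
        (hgψ.comp ((Computable.const 0).pair (Computable.snd.comp .fst)))
        (hgP.comp (Computable.snd.pair (Computable.snd.comp (Computable.fst.comp .fst)))))
  · rintro (_ | _ | i) n j
    · exact hφ () n j
    · exact hψ () n j
    · exact hP i n j

end BaseFormula

end BaseFormulas

/-! ### Interpretations along a surjection -/

section KernelQuotient

variable {L' : Language} [L'.IsRelational] {X A : Type*} [L'.Structure A]

/-- The relations of a relational structure pulled back along a map; they are invariant under the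
kernel of the map. -/
@[reducible] def kerPrestructure (F : X → A) : L'.Prestructure (Setoid.ker F) where
  toStructure :=
    { funMap := fun f _ => isEmptyElim f
      RelMap := fun R xs => Language.Structure.RelMap R (F ∘ xs) }
  fun_equiv {_ f} := isEmptyElim f
  rel_equiv {_ R} _ _ h :=
    congrArg (Language.Structure.RelMap (M := A) R) (funext fun p => Setoid.ker_def.1 (h p))

theorem nonempty_equiv_quotient_ker {F : X → A} (hF : Function.Surjective F) :
    let _ := kerPrestructure (L' := L') F
    Nonempty (A ≃[L'] Quotient (Setoid.ker F)) := by
  let _ := kerPrestructure (L' := L') F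
  let q : Quotient (Setoid.ker F) ≃ A := Setoid.quotientKerEquivOfSurjective F hF
  refine ⟨Language.Equiv.symm ⟨q, fun f => isEmptyElim f, fun R x => ?_⟩⟩
  obtain ⟨y, rfl⟩ : ∃ y, x = fun p => Quotient.mk (Setoid.ker F) (y p) :=
    ⟨fun p => (x p).out, funext fun p => (x p).out_eq.symm⟩
  exact (Language.relMap_quotient_mk' (Setoid.ker F) R y).symm

end KernelQuotient

section Criterion

variable {L : Language} [ComputableLanguage L] {A B : Type*} [L.Structure B] {D : Set (Tuple B)}

/-- The preimages of the relations `T i` under `F` are defined by a computable sequence of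
generalized computable `Σ₁` formulas. -/
def PullbackDefinable (L : Language) [ComputableLanguage L] [L.Structure B] {ι : Type*}
    (key : ι → ℕ) {r : ι → ℕ} (F : D → A) (T : ∀ i, (Fin (r i) → A) → Prop) : Prop :=
  ∃ Φ : ∀ i, GenSigmaOne L (r i), IsComputableSeq key Φ ∧
    ∀ i (xs : Fin (r i) → Tuple B),
      (Φ i).Holds xs ↔ ∃ h : ∀ p, xs p ∈ D, T i fun p => F ⟨xs p, h p⟩

theorem EffectivelyInterpreted.of_surjective {L' : Language} [ComputableLanguage L']
    [L'.IsRelational] [L'.Structure A] {F : D → A} (hF : Function.Surjective F)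
    (hdom : PullbackDefinable L (fun _ : Unit => 0) (r := fun _ => 1) F fun _ _ => True)
    (heqv : PullbackDefinable L (fun _ : Unit => 0) (r := fun _ => 2) F fun _ a => a 0 = a 1)
    (hneqv : PullbackDefinable L (fun _ : Unit => 0) (r := fun _ => 2) F fun _ a => a 0 ≠ a 1)
    (hpos : PullbackDefinable L ComputableLanguage.relCode F
      fun R : Σ n, L'.Relations n => Language.Structure.RelMap R.2)
    (hneg : PullbackDefinable L ComputableLanguage.relCode F
      fun (R : Σ n, L'.Relations n) a => ¬ Language.Structure.RelMap R.2 a) :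
    EffectivelyInterpreted L L' A B := by
  obtain ⟨dom, hdom, holds_dom⟩ := hdom
  obtain ⟨eqv, heqv, holds_eqv⟩ := heqv
  obtain ⟨neqv, hneqv, holds_neqv⟩ := hneqv
  refine ⟨D, Setoid.ker F, kerPrestructure F, nonempty_equiv_quotient_ker hF,
    ⟨dom (), hdom, fun x => (holds_dom () _).trans ?_⟩,
    ⟨eqv (), heqv, fun x y => (holds_eqv () _).trans ?_⟩,
    ⟨neqv (), hneqv, fun x y => (holds_neqv () _).trans ?_⟩, hpos, hneg⟩
  · exact ⟨fun ⟨h, _⟩ => h 0, fun h => ⟨fun _ => by simpa using h, trivial⟩⟩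
  · exact ⟨fun ⟨h, e⟩ => ⟨h 0, h 1, e⟩, fun ⟨hx, hy, e⟩ => ⟨Fin.forall_fin_two.2 ⟨hx, hy⟩, e⟩⟩
  · exact ⟨fun ⟨h, e⟩ => ⟨h 0, h 1, e⟩, fun ⟨hx, hy, e⟩ => ⟨Fin.forall_fin_two.2 ⟨hx, hy⟩, e⟩⟩

end Criterion

section Automorphisms

variable {L : Language} {B : Type*} [L.Structure B]

theorem SigmaOne.realize_comp_equiv {α : Type*} (φ : SigmaOne L α) (g : B ≃[L] B) (v : α → B) :
    φ.Realize (g ∘ v) ↔ φ.Realize v := by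
  refine exists_congr fun j => exists_congr fun d => and_congr_right fun _ => ?_
  refine (g.toEquiv.surjective.comp_left.exists).trans (exists_congr fun y => ?_)
  exact Language.StrongHomClass.realize_boundedFormula g d.2.1

/-- The image of a tuple under a map. -/
def tupleMap {C : Type*} (g : B → C) (x : Tuple B) : Tuple C := ⟨x.1, g ∘ x.2⟩

theorem tupleMap_surjective {C : Type*} {g : B → C} (hg : Function.Surjective g) :
    Function.Surjective (tupleMap g) :=
  fun x => (hg.comp_left x.2).imp' (Sigma.mk x.1) fun _ hz => congrArg (Sigma.mk x.1) hz

theorem GenSigmaOne.holds_tupleMap {k : ℕ} (φ : GenSigmaOne L k) (g : B ≃[L] B)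
    (xs : Fin k → Tuple B) : φ.Holds (tupleMap g ∘ xs) ↔ φ.Holds xs :=
  SigmaOne.realize_comp_equiv _ g _

theorem GenSigmaOne.holds_cons_tupleMap {k : ℕ} (φ : GenSigmaOne L (k + 1)) (g : B ≃[L] B)
    (c : Tuple B) (xs : Fin k → Tuple B) :
    φ.Holds (Fin.cons (α := fun _ => Tuple B) (tupleMap g c) (tupleMap g ∘ xs)) ↔
      φ.Holds (Fin.cons (α := fun _ => Tuple B) c xs) := by
  rw [← Fin.comp_cons, holds_tupleMap]

variable [ComputableLanguage L] {L' : Language} [ComputableLanguage L'] [L'.IsRelational]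

theorem DefiningFormulas.EffectivelyDefine.holds_neg_iff {S : DefiningFormulas L L'} {A : Type*}
    [L'.Structure A] {l : ℕ} {b : Fin l → B} (hS : S.EffectivelyDefine A (⟨l, b⟩ : Tuple B))
    {c : Fin l → B} (hc : c ∈ autOrbit L b) (R : Σ n, L'.Relations n)
    (y : Fin R.1 → S.Domain (⟨l, c⟩ : Tuple B)) :
    (S.neg R).Holds (Fin.cons (α := fun _ => Tuple B) ⟨l, c⟩ fun p => (y p : Tuple B)) ↔
      ¬ Language.Structure.RelMap R.2 y := by
  obtain ⟨g, rfl⟩ := hc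
  obtain ⟨z, hz⟩ : ∃ z : Fin R.1 → Tuple B, tupleMap g ∘ z = fun p => (y p : Tuple B) :=
    (tupleMap_surjective g.toEquiv.surjective).comp_left _
  have hz_mem (p : Fin R.1) : z p ∈ S.Domain ⟨l, b⟩ := by
    have map_singleton : tupleMap g ∘ ![z p] = ![(y p : Tuple B)] :=
      funext (Fin.forall_fin_one.2 (congrFun hz p))
    refine (S.dom.holds_cons_tupleMap g ⟨l, b⟩ ![z p]).1 ?_
    rw [map_singleton]
    exact (y p).2
  change _ ↔ ¬ (S.pos R).Holds (Fin.cons (α := fun _ => Tuple B) _ fun p => (y p : Tuple B))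
  rw [← hz]
  refine ((S.neg R).holds_cons_tupleMap g ⟨l, b⟩ z).trans (((hS.1 R z).2.trans
    (and_iff_right hz_mem)).trans (not_congr ?_))
  exact ((S.pos R).holds_cons_tupleMap g ⟨l, b⟩ z).symm

end Automorphisms

/-! ### Pairs of parameters and elements -/

section Pairs

variable {l : ℕ} {A B : Type*} {O : Set (Fin l → B)} {D : O → Set (Tuple B)}

/-- The pairs of a tuple `c` of parameters and an element `y` of `D c`, coded by the concatenation
of `c` and `y`. -/
def pairDomain (D : O → Set (Tuple B)) : Set (Tuple B) :=
  {x | ∃ c : O, tupleTake l x = ⟨l, c⟩ ∧ tupleDrop l x ∈ D c}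

/-- The common extension `(c, y) ↦ π c y` of a family of maps on the sets `D c` to the set of all
pairs. -/
noncomputable def pairMap (π : ∀ c, D c → A) (x : pairDomain D) : A :=
  π x.2.choose ⟨tupleDrop l x, x.2.choose_spec.2⟩

theorem pairMap_eq (π : ∀ c, D c → A) (x : pairDomain D) {c : O}
    (hc : tupleTake l x = (⟨l, c⟩ : Tuple B)) :
    ∃ hy : tupleDrop l x ∈ D c, pairMap π x = π c ⟨tupleDrop l x, hy⟩ := by
  obtain rfl : x.2.choose = c :=
    Subtype.ext (eq_of_heq (Sigma.mk.inj (x.2.choose_spec.1.symm.trans hc)).2)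
  exact ⟨x.2.choose_spec.2, rfl⟩

theorem tupleTake_append (c : Fin l → B) (x : Tuple B) :
    tupleTake l (tupleOf (List.ofFn c ++ List.ofFn x.2)) = ⟨l, c⟩ := by
  have h : (List.ofFn c ++ List.ofFn x.2).take l = List.ofFn c :=
    List.take_left' (List.length_ofFn)
  rw [tupleTake, show List.ofFn (tupleOf _).2 = _ from List.ofFn_get _, h]
  exact tupleOf_ofFn ⟨l, c⟩

theorem tupleDrop_append (c : Fin l → B) (x : Tuple B) :
    tupleDrop l (tupleOf (List.ofFn c ++ List.ofFn x.2)) = x := by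
  have h : (List.ofFn c ++ List.ofFn x.2).drop l = List.ofFn x.2 :=
    List.drop_left' (List.length_ofFn)
  rw [tupleDrop, show List.ofFn (tupleOf _).2 = _ from List.ofFn_get _, h]
  exact tupleOf_ofFn x

theorem pairMap_surjective {π : ∀ c, D c → A} {c : O} (hπ : Function.Surjective (π c)) :
    Function.Surjective (pairMap π) := by
  intro a
  obtain ⟨y, rfl⟩ := hπ a
  have take_eq := tupleTake_append c.1 y.1
  have drop_eq := tupleDrop_append c.1 y.1
  let x : pairDomain D := ⟨_, c, take_eq, by rw [drop_eq]; exact y.2⟩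
  obtain ⟨_, hx⟩ := pairMap_eq π x take_eq
  exact ⟨x, hx.trans (congrArg (π c) (Subtype.ext drop_eq))⟩

end Pairs

section PairFormulas

variable {L : Language} {ι : Type*} {r : ι → ℕ} {l : ℕ} {A B : Type*} [L.Structure B]
  {φ : GenSigmaOne L 1} {ψ : GenSigmaOne L 4} {P : ∀ i, GenSigmaOne L (r i + 1)}

/-- The conditions on `z` in the formula `∃ z₀ … z_r, orbit(z₀) ∧ rel(z₀, z₁, …, z_r) ∧
⋀ₚ orbit(take l xₚ) ∧ ⋀ₚ iso(take l xₚ, z₀, drop l xₚ, zₚ₊₁)`, which expresses a relation between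
pairs `xₚ` by moving their second components to common parameters `z₀`. -/
def pairAtoms (l : ℕ) (r : ι → ℕ) (i : ι) :
    List (TupleAtom (BaseFormula.arity r) (r i) (r i + 1)) :=
  ⟨.orbit, fun _ => .bound 0⟩ :: ⟨.rel i, fun p => .bound p⟩ ::
    ((List.finRange (r i)).map (fun p => ⟨.orbit, fun _ => .take l p⟩) ++
      (List.finRange (r i)).map fun p =>
        ⟨.iso, ![.take l p, .bound 0, .drop l p, .bound p.succ]⟩)

theorem forall_mem_pairAtoms_holds (i : ι) (xs : Fin (r i) → Tuple B)
    (z : Fin (r i + 1) → Tuple B) :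
    (∀ a ∈ pairAtoms l r i, a.Holds (BaseFormula.formula φ ψ P) xs z) ↔
      φ.Holds ![z 0] ∧ (P i).Holds z ∧ (∀ p, φ.Holds ![tupleTake l (xs p)]) ∧
        ∀ p, ψ.Holds ![tupleTake l (xs p), z 0, tupleDrop l (xs p), z p.succ] := by
  have const_eq (x : Tuple B) : (fun _ : Fin 1 => x) = ![x] := funext fun p => by simp
  simp only [pairAtoms, List.forall_mem_cons, List.forall_mem_append, List.forall_mem_map,
    List.mem_finRange, true_imp_iff, ← const_eq]
  refine and_congr_right' (and_congr_right' (and_congr_right' (forall_congr' fun p => ?_)))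
  refine iff_of_eq (congrArg ψ.Holds (funext fun q => ?_))
  fin_cases q <;> rfl

/-- The formula `φ(u)` defines the set of parameters, and for parameters `c`, `d` the formula
`ψ(c, d, x, y)` says that `x ∈ D c` and `y ∈ D d` represent the same element of `A`, where
`π c : D c → A` is the surjection that sends an element to what it represents. -/
structure DefinesRepresentations (φ : GenSigmaOne L 1) (ψ : GenSigmaOne L 4)
    {O : Set (Fin l → B)} {D : O → Set (Tuple B)} (π : ∀ c, D c → A) : Prop where
  surjective : ∀ c, Function.Surjective (π c)
  holds_orbit : ∀ u : Tuple B, φ.Holds ![u] ↔ ∃ c : O, u = ⟨l, c⟩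
  holds_iso : ∀ (c d : O) (x y : Tuple B), ψ.Holds ![⟨l, c⟩, ⟨l, d⟩, x, y] ↔
    ∃ (hx : x ∈ D c) (hy : y ∈ D d), π c ⟨x, hx⟩ = π d ⟨y, hy⟩

variable {O : Set (Fin l → B)} {D : O → Set (Tuple B)} {π : ∀ c, D c → A}

theorem exists_pairAtoms_holds_iff (hπ : DefinesRepresentations φ ψ π) (c₀ : O) {i : ι}
    {T : (Fin (r i) → A) → Prop}
    (holds_P : ∀ (c : O) (y : Fin (r i) → D c),
      (P i).Holds (Fin.cons (α := fun _ => Tuple B) ⟨l, c⟩ fun p => (y p : Tuple B)) ↔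
        T fun p => π c (y p))
    (xs : Fin (r i) → Tuple B) :
    (∃ z, ∀ a ∈ pairAtoms l r i, a.Holds (BaseFormula.formula φ ψ P) xs z) ↔
      ∃ h : ∀ p, xs p ∈ pairDomain D, T fun p => pairMap π ⟨xs p, h p⟩ := by
  simp only [forall_mem_pairAtoms_holds, hπ.holds_orbit, Fin.exists_fin_succ_pi, Fin.cons_zero,
    Fin.cons_succ]
  constructor
  · rintro ⟨_, z, ⟨c, rfl⟩, hP, hd, hψ⟩
    choose d hd using hd
    simp only [hd, hπ.holds_iso] at hψ
    choose hx hz hψ using hψ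
    have mem (p : Fin (r i)) : xs p ∈ pairDomain D := ⟨d p, hd p, hx p⟩
    have value (p : Fin (r i)) : pairMap π ⟨xs p, mem p⟩ = π c ⟨z p, hz p⟩ :=
      (pairMap_eq π ⟨xs p, mem p⟩ (hd p)).choose_spec.trans (hψ p)
    exact ⟨mem, by simpa only [value] using (holds_P c fun p => ⟨z p, hz p⟩).1 hP⟩
  · rintro ⟨mem, hT⟩
    choose z hz using fun p => hπ.surjective c₀ (pairMap π ⟨xs p, mem p⟩)
    choose d hd _ using fun p => mem p
    refine ⟨⟨l, c₀⟩, fun p => z p, ⟨c₀, rfl⟩, (holds_P c₀ z).2 (by simpa only [hz] using hT),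
      fun p => ⟨d p, hd p⟩, fun p => ?_⟩
    obtain ⟨hx, value⟩ := pairMap_eq π ⟨xs p, mem p⟩ (hd p)
    rw [hd p, hπ.holds_iso]
    exact ⟨hx, (z p).2, value.symm.trans (hz p).symm⟩

theorem exists_computable_pairAtoms (l : ℕ) (r key : ι → ℕ) :
    ∃ h : ℕ × ℕ → List (ℕ × List (ℕ × ℕ × ℕ)), Computable h ∧
      ∀ i, h (key i, r i) = (pairAtoms l r i).map (TupleAtom.code (BaseFormula.number key)) := by
  let isoArgs (p : ℕ) : List (ℕ × ℕ × ℕ) := [(0, l, p), (2, 0, 0), (1, l, p), (2, 0, p + 1)]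
  have letter (m : ℕ) : Primrec fun p : ℕ => (m, l, p) :=
    (Primrec.const m).pair ((Primrec.const l).pair .id)
  have bound {f : ℕ → ℕ} (hf : Primrec f) : Primrec fun p => ((2, 0, f p) : ℕ × ℕ × ℕ) :=
    (Primrec.const 2).pair ((Primrec.const 0).pair hf)
  have isoArgs_primrec : Primrec isoArgs :=
    Primrec.list_cons.comp (letter 0) (Primrec.list_cons.comp (.const _)
      (Primrec.list_cons.comp (letter 1) (Primrec.list_cons.comp (bound .succ) (.const []))))
  refine ⟨fun x => (0, [(2, 0, 0)]) ::
    (x.1 + 2, (List.range (x.2 + 1)).map fun p => (2, 0, p)) ::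
      ((List.range x.2).map (fun p => (0, [(0, l, p)])) ++
        (List.range x.2).map fun p => (1, isoArgs p)), Primrec.to_comp ?_, fun i => ?_⟩
  · have range_succ : Primrec fun x : ℕ × ℕ => List.range (x.2 + 1) :=
      Primrec.list_range.comp (Primrec.succ.comp .snd)
    have range : Primrec fun x : ℕ × ℕ => List.range x.2 := Primrec.list_range.comp .snd
    refine Primrec.list_cons.comp (.const _) (Primrec.list_cons.comp
      ((Primrec.nat_add.comp .fst (.const 2)).pair
        (Primrec.list_map range_succ ((bound .id).comp .snd)))
      (Primrec.list_append.comp (Primrec.list_map range ?_) (Primrec.list_map range ?_)))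
    · exact (Primrec.const 0).pair (Primrec.list_cons.comp ((letter 0).comp .snd) (.const []))
    · exact (Primrec.const 1).pair (isoArgs_primrec.comp .snd)
  · simp only [pairAtoms, List.map_cons, List.map_append, List.map_map,
      ← List.map_coe_finRange_eq_range, TupleAtom.code, Function.comp_def, List.ofFn_eq_map]
    rfl

namespace DefinesRepresentations

theorem holds_reindex_iso (hπ : DefinesRepresentations φ ψ π) {m : ℕ} (c : O) (y : Fin m → D c)
    (p q : Fin m) :
    (ψ.reindex ![0, 0, p.succ, q.succ]).Holds
        (Fin.cons (α := fun _ => Tuple B) ⟨l, c⟩ fun p => (y p : Tuple B)) ↔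
      π c (y p) = π c (y q) := by
  have args_eq : (Fin.cons (α := fun _ => Tuple B) ⟨l, c⟩ fun p => (y p : Tuple B)) ∘
      ![0, 0, p.succ, q.succ] = ![⟨l, c⟩, ⟨l, c⟩, (y p : Tuple B), (y q : Tuple B)] := by
    funext s
    fin_cases s <;> rfl
  rw [GenSigmaOne.holds_reindex, args_eq, hπ.holds_iso]
  exact ⟨fun ⟨_, _, h⟩ => h, fun h => ⟨(y p).2, (y q).2, h⟩⟩

variable [ComputableLanguage L]

theorem pullbackDefinable {key : ι → ℕ} (hπ : DefinesRepresentations φ ψ π) (c₀ : O)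
    (hφ : φ.IsComputable) (hψ : ψ.IsComputable) (hP : IsComputableSeq key P)
    {T : ∀ i, (Fin (r i) → A) → Prop}
    (holds_P : ∀ (i : ι) (c : O) (y : Fin (r i) → D c),
      (P i).Holds (Fin.cons (α := fun _ => Tuple B) ⟨l, c⟩ fun p => (y p : Tuple B)) ↔
        T i fun p => π c (y p)) :
    PullbackDefinable L key (pairMap π) T := by
  obtain ⟨h, hh, codes⟩ := exists_computable_pairAtoms l r key
  refine ⟨_, (BaseFormula.isComputableSeq_formula hφ hψ hP).primitivePositive hh codes,
    fun i xs => ?_⟩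
  rw [GenSigmaOne.holds_primitivePositive]
  exact exists_pairAtoms_holds_iff hπ c₀ (holds_P i) xs

theorem pullbackDefinable_true (hπ : DefinesRepresentations φ ψ π) (c₀ : O)
    (hφ : φ.IsComputable) (hψ : ψ.IsComputable) :
    PullbackDefinable L (fun _ : Unit => 0) (r := fun _ => 1) (pairMap π) fun _ _ => True :=
  hπ.pullbackDefinable c₀ hφ hψ (hψ.reindex ![0, 0, 1, 1]) fun _ c y =>
    (hπ.holds_reindex_iso c y 0 0).trans (iff_of_true rfl trivial)

theorem pullbackDefinable_eq (hπ : DefinesRepresentations φ ψ π) (c₀ : O)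
    (hφ : φ.IsComputable) (hψ : ψ.IsComputable) :
    PullbackDefinable L (fun _ : Unit => 0) (r := fun _ => 2) (pairMap π) fun _ a => a 0 = a 1 :=
  hπ.pullbackDefinable c₀ hφ hψ (hψ.reindex ![0, 0, 1, 2]) fun _ c y =>
    hπ.holds_reindex_iso c y 0 1

theorem pullbackDefinable_ne (hπ : DefinesRepresentations φ ψ π) (c₀ : O)
    (hφ : φ.IsComputable) (hψ : ψ.IsComputable) (injective : ∀ c, Function.Injective (π c)) :
    PullbackDefinable L (fun _ : Unit => 0) (r := fun _ => 2) (pairMap π) fun _ a => a 0 ≠ a 1 :=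
  hπ.pullbackDefinable c₀ hφ hψ (isComputable_tupleNe 1 2) fun _ c _ =>
    (holds_tupleNe _ _ _).trans
      (Subtype.coe_injective.ne_iff.trans (injective c).ne_iff.symm)

end DefinesRepresentations

end PairFormulas

theorem mainTheorem6 {L L' : Language} [ComputableLanguage L] [ComputableLanguage L']
    [L'.IsRelational] {A B : Type*} [L'.Structure A] [L.Structure B]
    {l : ℕ} (b : Fin l → B)
    (S : DefiningFormulas L L') (hS : S.EffectivelyDefine A (⟨l, b⟩ : Tuple B))
    (φ : SigmaOne L (TupleVar fun _ : Fin 1 => l)) (hφ : φ.IsComputable)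
    (hφ_orbit : ∀ c : Fin l → B, φ.Realize (fun v => c v.2) ↔ c ∈ autOrbit L b)
    (ψ : GenSigmaOne L 4) (hψ : ψ.IsComputable)
    (f : ∀ c d : autOrbit L b, S.Domain ⟨l, c.1⟩ ≃[L'] S.Domain ⟨l, d.1⟩)
    (hψ_graph : ∀ (c d : autOrbit L b) (x y : Tuple B),
      ψ.Holds ![⟨l, c.1⟩, ⟨l, d.1⟩, x, y] ↔
        ∃ hx : x ∈ S.Domain ⟨l, c.1⟩, ((f c d ⟨x, hx⟩ : S.Domain ⟨l, d.1⟩) : Tuple B) = y)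
    (hf_id : ∀ (c : autOrbit L b) (x : S.Domain ⟨l, c.1⟩), f c c x = x)
    (hf_comp : ∀ (c d e : autOrbit L b) (x : S.Domain ⟨l, c.1⟩),
      f d e (f c d x) = f c e x) :
    EffectivelyInterpreted L L' A B := by
  obtain ⟨e⟩ := hS.2
  let c₀ : autOrbit L b := ⟨b, Language.Equiv.refl L B, rfl⟩
  let π (c : autOrbit L b) : S.Domain ⟨l, c.1⟩ ≃[L'] A := e.symm.comp (f c c₀)
  have f_eq_iff (c d : autOrbit L b) (x : S.Domain ⟨l, c.1⟩) (y : S.Domain ⟨l, d.1⟩) :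
      f c d x = y ↔ π c x = π d y := by
    rw [← (π d).injective.eq_iff]
    exact iff_of_eq (congrArg (e.symm · = π d y) (hf_comp c d c₀ x))
  have hπ : DefinesRepresentations (GenSigmaOne.ofLengths φ) ψ fun c => π c :=
    { surjective := fun c => (π c).surjective
      holds_orbit := fun u => by
        simp only [GenSigmaOne.holds_ofLengths_singleton, hφ_orbit, Subtype.exists, and_comm,
          exists_prop]
      holds_iso := fun c d x y => (hψ_graph c d x y).trans <| exists_congr fun hx =>
        ⟨fun h => ⟨h ▸ Subtype.prop _, (f_eq_iff ..).1 (Subtype.ext h)⟩,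
          fun ⟨_, h⟩ => congrArg Subtype.val ((f_eq_iff ..).2 h)⟩ }
  exact EffectivelyInterpreted.of_surjective (pairMap_surjective (π c₀).surjective)
    (hπ.pullbackDefinable_true c₀ hφ.ofLengths hψ)
    (hπ.pullbackDefinable_eq c₀ hφ.ofLengths hψ)
    (hπ.pullbackDefinable_ne c₀ hφ.ofLengths hψ fun c => (π c).injective)
    (hπ.pullbackDefinable c₀ hφ.ofLengths hψ S.pos_computable fun R c y =>
      ((π c).map_rel R.2 y).symm)
    (hπ.pullbackDefinable c₀ hφ.ofLengths hψ S.neg_computable fun R c y =>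
      (hS.holds_neg_iff c.2 R y).trans (not_congr ((π c).map_rel R.2 y).symm))
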